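/- **Setting.** Let $d\ge 2$, let $e_1,e_2$ be the first two standard basis vectors of $\mathbb R^d$, and put $\alpha=\frac1{800}$, $\tau=\max\{7,d^{1/10}\}$, $\rho=d^{-1.5}$, $n=d^2$. Draw i.i.d. datapoints $x_i=c_i+\rho\,\xi_i$, $i=1,\dots,n$, where $c_i$ is uniform on the four vectors $e_1,\ e_1+\tau e_2,\ -e_1,\ -e_1+\tau e_2$ and $\xi_i\sim\mathcal N(0,I_d)$ is independent of $c_i$. Let $\sigma(x)=\frac{1}{1+e^{-x}}$, applied coordinatewise. For $W=[w_1,w_2]^\top\in\mathbb R^{2\times d}$ let $$L(W)=\alpha\|W\|_F^2-\frac1n\sum_{i=1}^n\mathbb E_{\xi,\xi'}\big\langle\sigma(W(x_i+\xi)),\,\sigma(W(x_i+\xi'))\big\rangle,$$ where $\xi,\xi'\sim\mathcal N(0,\rho^2I_d)$ are independent, and let $\widetilde L(W)=\alpha\|W\|_F^2-\mathbb E_{\widetilde x}\langle\sigma(W\widetilde x),\sigma(W\widetilde x)\rangle$ with $\widetilde x$ uniform on the four vectors above. Write $x^{(k)}$ for the $k$-th coordinate of $x\in\mathbb R^d$,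 and let $$D_1(\tau)=\Big\{x\in\mathbb R^d: x^{(1)}\in(3.1,3.9),\ \tau x^{(2)}\in(8.5,9),\ |x^{(k)}|<\tfrac{3}{d^{0.49}}\ \text{for } 3\le k\le d\Big\},$$ and define $D_2(\tau)$ in the same way with $x^{(1)}\in(-3.9,-3.1)$. **Theorem.** There is an absolute constant $C>0$, independent of $d$, such that for every $d\ge2$ the following holds. There is a (non-random) critical point $(\widetilde w_1^*,\widetilde w_2^*)$ of $\widetilde L$, which is a local minimum of $\widetilde L$, with $$\widetilde w_1^{*(1)}=-\widetilde w_2^{*(1)}\in[3.1,3.9],\qquad \tau\widetilde w_1^{*(2)}=\tau\widetilde w_2^{*(2)}\ge 9,\qquad \widetilde w_1^{*(k)}=\widetilde w_2^{*(k)}=0\ \ (3\le k\le d),$$ such that, with probability at least $1-Ce^{-d^{1/10}}$ over the data, $L$ has a local minimum $(w_1^*,w_2^*)$ with all of the following properties. 1. $\|w_j^*-\widetilde w_j^*\|_2\le C d^{-1/2}$ for $j=1,2$. 2. For every initialization $(w_1(0),w_2(0))\in D_1(\tau)\times D_2(\tau)$, gradient descent $W(t+1)=W(t)-\eta\nabla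 L(W(t))$ with learning rate $\eta=\frac{2}{4\alpha+\tau^2+1.5}$ satisfies, for all $t\ge0$ and $j=1,2$, $$\|w_j(t)-w_j^*\|_2\le\Big(\frac{\kappa-1}{\kappa+1}\Big)^t\|w_j(0)-w_j^*\|_2,\qquad \kappa=1+\frac{\tau^2+1.5+2d^{-0.1}}{2\alpha-d^{-0.1}}.$$ 3. If $\Pi$ denotes the orthogonal projection onto $\mathrm{span}\{w_1^*,w_2^*\}$, then $\|\Pi e_j\|_2\ge 1-C\tau^3d^{-1/2}$ for $j=1,2$. (The probability bound has content only for large $d$; for bounded $d$ it is void when $C$ is large.) -/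

import Mathlib

noncomputable section

namespace SSL

/-- Euclidean space `ℝ^d`, with the `ℓ²` norm. -/
abbrev Vec (d : ℕ) : Type := EuclideanSpace ℝ (Fin d)

/-- Weight matrices `W = [w₁, w₂]ᵀ ∈ ℝ^{2 × d}`, given by their two rows `W 0 = w₁` and `W 1 = w₂`.
The norm of this Hilbert space is the Frobenius norm. -/
abbrev Weights (d : ℕ) : Type := PiLp 2 (fun _ : Fin 2 => Vec d)

/-- The `k`-th standard basis vector of `ℝ^d`, counted from `k = 0`:
`stdVec d 0 = e₁` and `stdVec d 1 = e₂`. -/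
def stdVec (d k : ℕ) : Vec d := WithLp.toLp 2 fun i => if i.val = k then 1 else 0

/-- The `k`-th coordinate of `x ∈ ℝ^d`, counted from `k = 0`. -/
def coord {d : ℕ} (x : Vec d) (k : ℕ) : ℝ := if h : k < d then x ⟨k, h⟩ else 0

/-- The four noise-free datapoints `e₁`, `e₁ + τ e₂`, `-e₁`, `-e₁ + τ e₂`. -/
def center (d : ℕ) (τ : ℝ) : Fin 4 → Vec d :=
  ![stdVec d 0, stdVec d 0 + τ • stdVec d 1, -stdVec d 0, -stdVec d 0 + τ • stdVec d 1]

/-- A raw dataset of size `n`: for each index, the kind of the datapoint (one of four) and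
its noise vector `ξᵢ`. -/
abbrev Sample (d n : ℕ) : Type := Fin n → Fin 4 × Vec d

/-- The law of the raw dataset: the `n` entries are i.i.d., the kind is uniform on the four kinds,
and the noise is an independent standard Gaussian vector `N(0, I)`. -/
def sampleLaw (d n : ℕ) : MeasureTheory.Measure (Sample d n) :=
  MeasureTheory.Measure.pi fun _ : Fin n =>
    (ProbabilityTheory.uniformOn (Set.univ : Set (Fin 4))).prod
      (ProbabilityTheory.stdGaussian (Vec d))

/-- The `i`-th datapoint `xᵢ = (noise-free datapoint) + ρ ξᵢ`. -/
def datapoint {d n : ℕ} (τ ρ : ℝ) (S : Sample d n) (i : Fin n) : Vec d :=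
  center d τ (S i).1 + ρ • (S i).2

/-- The law `N(0, ρ² I)` of a data augmentation. -/
def augLaw (d : ℕ) (ρ : ℝ) : MeasureTheory.Measure (Vec d) :=
  (ProbabilityTheory.stdGaussian (Vec d)).map fun z => ρ • z

/-- The encoder `x ↦ σ(W x) ∈ ℝ²`, with the sigmoid function applied coordinatewise. -/
def encode {d : ℕ} (W : Weights d) (x : Vec d) : EuclideanSpace ℝ (Fin 2) :=
  WithLp.toLp 2 fun j => Real.sigmoid (inner ℝ (W j) x)

/-- The SSL objective
`L(W) = α ‖W‖_F² - (1/n) ∑ᵢ E_{ξ,ξ'} ⟨σ(W (xᵢ + ξ)), σ(W (xᵢ + ξ'))⟩`,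
where `ξ, ξ' ∼ N(0, ρ² I)` are independent. -/
def loss {d n : ℕ} (α τ ρ : ℝ) (S : Sample d n) (W : Weights d) : ℝ :=
  α * ‖W‖ ^ 2 - (1 / (n : ℝ)) * ∑ i : Fin n,
    ∫ ξ : Vec d × Vec d,
      inner ℝ (encode W (datapoint τ ρ S i + ξ.1)) (encode W (datapoint τ ρ S i + ξ.2))
      ∂((augLaw d ρ).prod (augLaw d ρ))

/-- The noise-free population objective `α ‖W‖_F² - E_x̃ ⟨σ(W x̃), σ(W x̃)⟩`, where `x̃` is uniform
on the four noise-free datapoints. -/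
def noiseFreeLoss (d : ℕ) (α τ : ℝ) (W : Weights d) : ℝ :=
  α * ‖W‖ ^ 2 - (1 / 4) * ∑ c : Fin 4,
    inner ℝ (encode W (center d τ c)) (encode W (center d τ c))

/-- The initialization region for `w₁`. -/
def D₁ (d : ℕ) (τ : ℝ) : Set (Vec d) :=
  {x | coord x 0 ∈ Set.Ioo (3.1 : ℝ) 3.9 ∧ τ * coord x 1 ∈ Set.Ioo (8.5 : ℝ) 9 ∧
    ∀ k, 2 ≤ k → k < d →
      coord x k ∈ Set.Ioo (-(3 / (d : ℝ) ^ (0.49 : ℝ))) (3 / (d : ℝ) ^ (0.49 : ℝ))}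

/-- The initialization region for `w₂`. -/
def D₂ (d : ℕ) (τ : ℝ) : Set (Vec d) :=
  {x | coord x 0 ∈ Set.Ioo (-3.9 : ℝ) (-3.1) ∧ τ * coord x 1 ∈ Set.Ioo (8.5 : ℝ) 9 ∧
    ∀ k, 2 ≤ k → k < d →
      coord x k ∈ Set.Ioo (-(3 / (d : ℝ) ^ (0.49 : ℝ))) (3 / (d : ℝ) ^ (0.49 : ℝ))}

/-- `W` is a trajectory of gradient descent on `f` with constant learning rate `η`. -/
def IsGradientDescent {d : ℕ} (f : Weights d → ℝ) (η : ℝ) (W : ℕ → Weights d) : Prop :=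
  ∀ t, W (t + 1) = W t - η • gradient f (W t)

/-- The length of the orthogonal projection of `v` onto the span of the rows of `W`. -/
def projLength {d : ℕ} (W : Weights d) (v : Vec d) : ℝ :=
  ‖(Submodule.span ℝ ({W 0, W 1} : Set (Vec d))).starProjection v‖

end SSL

end

/-! The two augmentations are independent, so the expected inner product splits into squares of
averaged sigmoids. Hence the loss is a sum of one function per row (`loss_eq_add`), and gradient
descent runs on each neuron separately. Everything is proved for one neuron, with a sign `ς` that
tells the two rows apart.

Noise-free neuron. Put `a = w⁽¹⁾` and `s = τ w⁽²⁾`. The function `σ²` is concave on `[3, ∞)`, and so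
is the even combination `σ²(x) + σ²(-x)` for `|x| ≥ 3`. On `goodRegion` (`|a|` in `[3, 4]`, `s ≥ 8`)
the loss is therefore the strongly convex `α‖w‖²` plus a convex part. The gradient difference is `(w
- v)/400 + b`, where `b` is a sum of three nonnegative rank-one terms satisfying the cocoercivity
bound `‖b‖² ≤ (1 + τ²/2)⟪b, w - v⟫` (`exists_noiseFreeNeuronGrad_sub`). Explicit estimates of
exponentials show that negative gradient steps at the walls of the region point inwards. So a
minimizer over a compact convex piece is interior, hence a genuine local minimum, and descent cannot
leave through these walls. Reflecting the first coordinate gives the second neuron.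

Perturbation. Let `T = d^(1/10)`, so `d = T^10`, `n = T^20`, `ρ = T^(-15)`. Outside an event of
probability `O(e^(-T))`, all noise coordinates are at most `T` and all four kinds have frequency
`1/4` up to `T^(-6)` (`sampleLaw_bad_le`). Then the empirical gradient differs from the noise-free
one by at most `9/T^5`, and the difference has Lipschitz constant at most `1/T`
(`gradient_error_bounds`). Strong convexity turns the first bound into a local minimum at distance
`O(T^(-5)) = O(d^(-1/2))`. The second bound lowers the strong convexity from `1/400` to `1/400 -
1/T`, which gives exactly the rate `(κ - 1)/(κ + 1)` (`norm_descent_le`, `condition_rate_eq`).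

The noise-free rows are `±a e₁ + b e₂`; half their difference and half their sum recover multiples
of `e₁` and `e₂`, which gives the projection bound. For `T < 1000` the constant makes the
probability bound trivial. -/

namespace SSL
open Real

/-! ### Calculus and numerical bounds for the sigmoid and its square. -/

/-- The derivative of the sigmoid function. -/
noncomputable def sigmoidD (x : ℝ) : ℝ := sigmoid x * (1 - sigmoid x)

/-- The second derivative of the sigmoid function. -/
noncomputable def sigmoidD2 (x : ℝ) : ℝ := sigmoidD x * (1 - 2 * sigmoid x)

/-- The derivative of the squared sigmoid function. -/
noncomputable def sqSigmoidD (x : ℝ) : ℝ := 2 * sigmoid x * sigmoidD x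

/-- The second derivative of the squared sigmoid function. -/
noncomputable def sqSigmoidD2 (x : ℝ) : ℝ := 2 * sigmoid x * sigmoidD x * (2 - 3 * sigmoid x)

lemma hasDerivAt_sigmoid' (x : ℝ) : HasDerivAt sigmoid (sigmoidD x) x := hasDerivAt_sigmoid x

lemma hasDerivAt_sigmoidD (x : ℝ) : HasDerivAt sigmoidD (sigmoidD2 x) x := by
  have h := hasDerivAt_sigmoid' x
  convert! h.mul (h.const_sub 1) using 1
  simp only [sigmoidD2]; ring

lemma hasDerivAt_sigmoidD2 (x : ℝ) :
    HasDerivAt sigmoidD2 (sigmoidD x * (1 - 6 * sigmoidD x)) x := by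
  have h := hasDerivAt_sigmoid' x
  convert! (hasDerivAt_sigmoidD x).mul ((h.const_mul 2).const_sub 1) using 1
  simp only [sigmoidD2, sigmoidD]; ring

lemma hasDerivAt_sq_sigmoid (x : ℝ) : HasDerivAt (fun y => sigmoid y ^ 2) (sqSigmoidD x) x := by
  convert! (hasDerivAt_sigmoid' x).pow 2 using 1
  simp [sqSigmoidD]

lemma hasDerivAt_sqSigmoidD (x : ℝ) : HasDerivAt sqSigmoidD (sqSigmoidD2 x) x := by
  convert! ((hasDerivAt_sigmoid' x).const_mul 2).mul (hasDerivAt_sigmoidD x) using 1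
  simp only [sqSigmoidD2, sigmoidD2, sigmoidD]; ring

lemma sigmoidD_pos (x : ℝ) : 0 < sigmoidD x :=
  mul_pos (sigmoid_pos x) (by linarith [sigmoid_lt_one x])

lemma sigmoidD_le (x : ℝ) : sigmoidD x ≤ 1 / 4 := by
  unfold sigmoidD; nlinarith [sq_nonneg (sigmoid x - 1 / 2)]

lemma abs_sigmoid_le (x : ℝ) : |sigmoid x| ≤ 1 := by
  rw [abs_of_pos (sigmoid_pos x)]; exact sigmoid_le_one x

lemma abs_sigmoidD_le (x : ℝ) : |sigmoidD x| ≤ 1 := by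
  rw [abs_of_pos (sigmoidD_pos x)]; linarith [sigmoidD_le x]

lemma abs_sigmoidD2_le (x : ℝ) : |sigmoidD2 x| ≤ 1 := by
  have h1 : |1 - 2 * sigmoid x| ≤ 1 :=
    abs_le.2 ⟨by linarith [sigmoid_lt_one x], by linarith [sigmoid_pos x]⟩
  rw [sigmoidD2, abs_mul]
  exact mul_le_one₀ (abs_sigmoidD_le x) (abs_nonneg _) h1

lemma abs_sigmoidD3_le (x : ℝ) : |sigmoidD x * (1 - 6 * sigmoidD x)| ≤ 1 := by
  have h1 := sigmoidD_pos x
  have h2 := sigmoidD_le x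
  rw [abs_mul]
  exact mul_le_one₀ (abs_sigmoidD_le x) (abs_nonneg _) (abs_le.2 ⟨by linarith, by linarith⟩)

lemma sqSigmoidD_pos (x : ℝ) : 0 < sqSigmoidD x :=
  mul_pos (mul_pos two_pos (sigmoid_pos x)) (sigmoidD_pos x)

lemma abs_sqSigmoidD_le (x : ℝ) : |sqSigmoidD x| ≤ 1 := by
  rw [abs_of_pos (sqSigmoidD_pos x)]
  unfold sqSigmoidD
  nlinarith [sigmoidD_le x, sigmoidD_pos x, sigmoid_le_one x, sigmoid_pos x]

lemma abs_sqSigmoidD2_le (x : ℝ) : |sqSigmoidD2 x| ≤ 1 := by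
  have h1 := sigmoidD_le x
  have h2 := sigmoidD_pos x
  have h3 := sigmoid_le_one x
  have h4 := sigmoid_pos x
  have h5 : 0 ≤ 2 * sigmoid x * sigmoidD x := by positivity
  have h6 : 2 * sigmoid x * sigmoidD x ≤ 1 / 2 := by nlinarith
  rw [sqSigmoidD2, abs_mul, abs_of_nonneg h5]
  have h7 : |2 - 3 * sigmoid x| ≤ 2 := abs_le.2 ⟨by linarith, by linarith⟩
  nlinarith [abs_nonneg (2 - 3 * sigmoid x)]

lemma abs_sub_le_of_hasDerivAt {f f' : ℝ → ℝ} (hf : ∀ x, HasDerivAt f (f' x) x)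
    (hb : ∀ x, |f' x| ≤ 1) (x y : ℝ) : |f x - f y| ≤ |x - y| := by
  simpa using Convex.norm_image_sub_le_of_norm_hasDerivWithin_le (C := 1)
    (fun z _ => (hf z).hasDerivWithinAt) (fun z _ => hb z) convex_univ
    (Set.mem_univ y) (Set.mem_univ x)

/-- The mean value theorem on an interval. -/
lemma exists_sub_eq_deriv_mul {f f' : ℝ → ℝ} (hf : ∀ x, HasDerivAt f (f' x) x) {s : Set ℝ}
    [hs : s.OrdConnected] {x y : ℝ} (hx : x ∈ s) (hy : y ∈ s) :
    ∃ z ∈ s, f x - f y = f' z * (x - y) := by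
  have hc : Continuous f := continuous_iff_continuousAt.2 fun z => (hf z).continuousAt
  rcases lt_trichotomy x y with h | h | h
  · obtain ⟨z, hz, h'⟩ := exists_hasDerivAt_eq_slope f f' h hc.continuousOn fun z _ => hf z
    refine ⟨z, hs.out hx hy ⟨hz.1.le, hz.2.le⟩, ?_⟩
    rw [h']; have : y - x ≠ 0 := by linarith
    field_simp; ring
  · exact ⟨x, hx, by simp [h]⟩
  · obtain ⟨z, hz, h'⟩ := exists_hasDerivAt_eq_slope f f' h hc.continuousOn fun z _ => hf z
    refine ⟨z, hs.out hy hx ⟨hz.1.le, hz.2.le⟩, ?_⟩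
    rw [h']; have : x - y ≠ 0 := by linarith
    field_simp

/-- The numerical estimates below all reduce to `exp (-3)`, `exp (-1)` and `exp (-0.1) ≥ 0.9`, with
the first two taken from decimal bounds for `e`. -/
lemma exp_neg_three_le : exp (-3) ≤ 0.0498 := by
  have h : exp (-3) = (exp 1 ^ 3)⁻¹ := by
    rw [exp_neg, ← exp_nat_mul]; norm_num
  rw [h, inv_le_comm₀ (by positivity) (by norm_num)]
  have h1 := exp_one_gt_d9
  calc (0.0498 : ℝ)⁻¹ ≤ 2.7182818283 ^ 3 := by norm_num
    _ ≤ _ := by gcongr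

lemma le_exp_neg_three : 0.0497 ≤ exp (-3) := by
  have h : exp (-3) = (exp 1 ^ 3)⁻¹ := by
    rw [exp_neg, ← exp_nat_mul]; norm_num
  rw [h, le_inv_comm₀ (by norm_num) (by positivity)]
  have h1 := exp_one_lt_d9
  calc exp 1 ^ 3 ≤ 2.7182818286 ^ 3 := by gcongr
    _ ≤ _ := by norm_num

lemma exp_neg_one_le : exp (-1) ≤ 0.36788 := by
  rw [exp_neg, inv_le_comm₀ (by positivity) (by norm_num)]
  exact le_trans (by norm_num) exp_one_gt_d9.le

lemma le_exp_neg_one : 0.36787 ≤ exp (-1) := by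
  rw [exp_neg, le_inv_comm₀ (by norm_num) (by positivity)]
  exact exp_one_lt_d9.le.trans (by norm_num)

lemma sigmoid_ge_of_three_le {x : ℝ} (hx : 3 ≤ x) : 0.95 ≤ sigmoid x := by
  have h : exp (-x) ≤ 0.0498 := (exp_le_exp.2 (by linarith)).trans exp_neg_three_le
  rw [sigmoid_def, le_inv_comm₀ (by norm_num) (by positivity)]
  exact le_trans (by linarith) (by norm_num : (1 + 0.0498 : ℝ) ≤ 0.95⁻¹)

/-- The factor `2 - 3σ` is negative once `σ > 2/3`, and `σ ≥ 0.95` here. -/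
lemma sqSigmoidD2_nonpos {x : ℝ} (hx : 3 ≤ x) : sqSigmoidD2 x ≤ 0 := by
  have h := sigmoid_ge_of_three_le hx
  exact mul_nonpos_of_nonneg_of_nonpos
    (mul_pos (mul_pos two_pos (sigmoid_pos x)) (sigmoidD_pos x)).le (by linarith)

/-- The centres `e₁` and `-e₁` give opposite arguments, one of them negative, where `σ²` alone is
convex. The pair must be treated together: the sum equals `2σ'(6σ' - 1)`, nonpositive as soon as `σ'
≤ 1/6`. -/
lemma sqSigmoidD2_add_neg_nonpos {x : ℝ} (hx : 3 ≤ |x|) :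
    sqSigmoidD2 x + sqSigmoidD2 (-x) ≤ 0 := by
  have key : sqSigmoidD2 x + sqSigmoidD2 (-x) = 2 * sigmoidD x * (6 * sigmoidD x - 1) := by
    simp only [sqSigmoidD2, sigmoidD, sigmoid_neg]; ring
  have h : sigmoidD x ≤ 1 / 6 := by
    have h1 : sigmoidD x = sigmoidD |x| := by
      rcases abs_choice x with h | h <;> rw [h]
      simp only [sigmoidD, sigmoid_neg]; ring
    rw [h1]
    have h2 := sigmoid_ge_of_three_le hx
    unfold sigmoidD
    nlinarith [sigmoid_le_one |x|]
  rw [key]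
  exact mul_nonpos_of_nonneg_of_nonpos (by linarith [sigmoidD_pos x]) (by linarith)

/-- As a rational function of `exp (-x)`, the derivative can be estimated from bounds on one
exponential. -/
lemma sqSigmoidD_eq (x : ℝ) : sqSigmoidD x = 2 * exp (-x) / (1 + exp (-x)) ^ 3 := by
  have h : 0 < 1 + exp (-x) := by positivity
  simp only [sqSigmoidD, sigmoidD, sigmoid_def]
  field_simp; ring

lemma sqSigmoidD_neg_eq (x : ℝ) :
    sqSigmoidD (-x) = 2 * exp (-x) ^ 2 / (1 + exp (-x)) ^ 3 := by
  have h : 0 < 1 + exp (-x) := by positivity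
  simp only [sqSigmoidD, sigmoidD, sigmoid_neg]
  simp only [sigmoid_def]
  field_simp; ring

lemma sqSigmoidD_le_exp (x : ℝ) : sqSigmoidD x ≤ 2 * exp (-x) := by
  rw [sqSigmoidD_eq]
  exact div_le_self (by positivity) (one_le_pow₀ (by linarith [exp_pos (-x)]))

lemma sqSigmoidD_neg_le_exp (x : ℝ) : sqSigmoidD (-x) ≤ 2 * exp (-x) ^ 2 := by
  rw [sqSigmoidD_neg_eq]
  exact div_le_self (by positivity) (one_le_pow₀ (by linarith [exp_pos (-x)]))

/-- Near `a = 3` the force on the first coordinate points outwards. -/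
lemma first_force_lower {a s : ℝ} (ha : 3 ≤ a) (ha' : a ≤ 3.1) (hs : 8 ≤ s) :
    a / 100 + 0.004 ≤
      sqSigmoidD a - sqSigmoidD (-a) + sqSigmoidD (s + a) - sqSigmoidD (s - a) := by
  have h1 : exp (-a) ≤ 0.0498 := (exp_le_exp.2 (by linarith)).trans exp_neg_three_le
  have h2 : 0.0447 ≤ exp (-a) := by
    have h3 : exp (-3) * exp (-0.1) ≤ exp (-a) := by
      rw [← exp_add]; exact exp_le_exp.2 (by linarith)
    have h4 : (0.9 : ℝ) ≤ exp (-0.1) := by linarith [add_one_le_exp (-0.1 : ℝ)]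
    nlinarith [le_exp_neg_three]
  have h5 : 0.0772 ≤ sqSigmoidD a := by
    rw [sqSigmoidD_eq, le_div_iff₀ (by positivity)]
    have : (1 + exp (-a)) ^ 3 ≤ 1.0498 ^ 3 := by gcongr; linarith
    nlinarith
  have h6 := sqSigmoidD_neg_le_exp a
  have h7 : exp (-(s - a)) ≤ 0.00752 := by
    have h8 : exp (-(s - a)) ≤ exp (-3) * exp (-1) * exp (-0.9) := by
      rw [← exp_add, ← exp_add]; exact exp_le_exp.2 (by linarith)
    have h9 : exp (-0.9) ≤ (0.409 : ℝ) := by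
      have : exp (-0.9) * exp (-0.1) = exp (-1) := by rw [← exp_add]; norm_num
      have h4 : (0.9 : ℝ) ≤ exp (-0.1) := by linarith [add_one_le_exp (-0.1 : ℝ)]
      nlinarith [exp_neg_one_le, exp_pos (-0.9)]
    calc _ ≤ _ := h8
      _ ≤ 0.0498 * 0.36788 * 0.409 := by
          gcongr
          · exact exp_neg_three_le
          · exact exp_neg_one_le
      _ ≤ _ := by norm_num
  have h10 := sqSigmoidD_le_exp (s - a)
  have h11 := sqSigmoidD_pos (s + a)
  nlinarith

/-- Near `a = 4` the force on the first coordinate points inwards. -/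
lemma first_force_upper {a s : ℝ} (ha : 3.9 ≤ a) (ha' : a ≤ 4) (hs : 8 ≤ s) :
    sqSigmoidD a - sqSigmoidD (-a) + sqSigmoidD (s + a) - sqSigmoidD (s - a) + 0.0005 ≤
      a / 100 := by
  have h4l : 0.01828 ≤ exp (-4) := by
    have : exp (-4) = exp (-3) * exp (-1) := by rw [← exp_add]; norm_num
    rw [this]; nlinarith [le_exp_neg_three, le_exp_neg_one]
  have h4u : exp (-4) ≤ 0.018321 := by
    have : exp (-4) = exp (-3) * exp (-1) := by rw [← exp_add]; norm_num
    rw [this]; nlinarith [exp_neg_three_le, exp_neg_one_le, exp_pos (-3), exp_pos (-1)]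
  have h1 : 0.01828 ≤ exp (-a) := h4l.trans (exp_le_exp.2 (by linarith))
  have h2 : exp (-a) ≤ 0.02036 := by
    have h3 : exp (-a) * exp (-0.1) ≤ exp (-4) := by
      rw [← exp_add]; exact exp_le_exp.2 (by linarith)
    have h4 : (0.9 : ℝ) ≤ exp (-0.1) := by linarith [add_one_le_exp (-0.1 : ℝ)]
    nlinarith [exp_pos (-a)]
  have h5 : sqSigmoidD a - sqSigmoidD (-a) ≤ 0.038 := by
    rw [sqSigmoidD_eq, sqSigmoidD_neg_eq, ← sub_div, div_le_iff₀ (by positivity)]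
    have : (1.01828 : ℝ) ^ 3 ≤ (1 + exp (-a)) ^ 3 := by gcongr; linarith
    nlinarith
  have h6 : sqSigmoidD (s + a) ≤ 0.0004 := by
    have h8 : exp (-(s + a)) ≤ exp (-3) * exp (-3) * exp (-3) := by
      rw [← exp_add, ← exp_add]; exact exp_le_exp.2 (by linarith)
    have h9 : exp (-3) * exp (-3) * exp (-3) ≤ 0.0498 * 0.0498 * 0.0498 := by
      gcongr <;> exact exp_neg_three_le
    have := sqSigmoidD_le_exp (s + a)
    norm_num at h9 ⊢
    linarith
  have h11 := sqSigmoidD_pos (s - a)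
  linarith

/-- Here `4 ≤ s - a ≤ 6` holds up to the wider range `[4, 6]`, so the sigmoid at `s - a` is not yet
saturated. After multiplication by `τ²/4` its force beats the regularization `s / 400` and pushes
`s` up. -/
lemma second_force_lower {a s : ℝ} (ha : 3 ≤ a) (ha' : a ≤ 4) (hs : 8 ≤ s) (hs' : s ≤ 9) :
    0.004 ≤ sqSigmoidD (s + a) + sqSigmoidD (s - a) := by
  have h1 : 0.00246 ≤ exp (-(s - a)) := by
    have h8 : exp (-3) * exp (-3) ≤ exp (-(s - a)) := by
      rw [← exp_add]; exact exp_le_exp.2 (by linarith)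
    nlinarith [le_exp_neg_three]
  have h2 : exp (-(s - a)) ≤ 0.0498 :=
    (exp_le_exp.2 (by linarith)).trans exp_neg_three_le
  have h5 : 0.004 ≤ sqSigmoidD (s - a) := by
    rw [sqSigmoidD_eq, le_div_iff₀ (by positivity)]
    have : (1 + exp (-(s - a))) ^ 3 ≤ 1.0498 ^ 3 := by gcongr; linarith
    nlinarith
  linarith [sqSigmoidD_pos (s + a)]

/-- At `w⁽²⁾ = 2` the argument is `s = 2τ`, and the regularization wins because the force decays
exponentially. Writing `2τ - 4 = 10 + (2τ - 14)`, the factor `e^(-10)` absorbs the constants and the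
remaining exponential absorbs `τ`. -/
lemma second_force_upper {a τ : ℝ} (ha : 3 ≤ a) (ha' : a ≤ 4) (hτ : 7 ≤ τ) :
    sqSigmoidD (2 * τ + a) + sqSigmoidD (2 * τ - a) < 2 * τ / (100 * τ ^ 2) := by
  have h1 : 2 * τ / (100 * τ ^ 2) = 1 / (50 * τ) := by field_simp; norm_num
  have h2 := sqSigmoidD_le_exp (2 * τ + a)
  have h3 := sqSigmoidD_le_exp (2 * τ - a)
  have h4 : exp (-(2 * τ + a)) ≤ exp (-(2 * τ - 4)) := exp_le_exp.2 (by linarith)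
  have h5 : exp (-(2 * τ - a)) ≤ exp (-(2 * τ - 4)) := exp_le_exp.2 (by linarith)
  have h6 : 4 * exp (-(2 * τ - 4)) < 1 / (50 * τ) := by
    rw [lt_div_iff₀ (by positivity)]
    have h7 : exp (-(2 * τ - 4)) = exp (-3) * exp (-3) * exp (-3) * exp (-1) * exp (-(2 * τ - 14)) := by
      rw [← exp_add, ← exp_add, ← exp_add, ← exp_add]; ring_nf
    have h8 : exp (-(2 * τ - 14)) * (2 * τ - 13) ≤ 1 := by
      have := add_one_le_exp (2 * τ - 14)
      rw [exp_neg, inv_mul_le_one₀ (exp_pos _)]; linarith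
    have h9 : exp (-3) * exp (-3) * exp (-3) * exp (-1) ≤ 0.0498 * 0.0498 * 0.0498 * 0.36788 := by
      gcongr
      exacts [exp_neg_three_le, exp_neg_three_le, exp_neg_three_le, exp_neg_one_le]
    have h10 : τ ≤ 7 * (2 * τ - 13) := by linarith
    have h11 : exp (-(2 * τ - 14)) * τ ≤ 7 := by
      nlinarith [exp_pos (-(2 * τ - 14))]
    rw [h7]
    have h12 : 0 ≤ exp (-(2 * τ - 14)) * τ := by positivity
    have h13 := mul_le_mul h9 h11 h12 (by norm_num)
    norm_num at h13 ⊢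
    linarith
  linarith

end SSL

/-! ### One neuron averaged over a random input close to a fixed centre. -/

namespace SSL
open MeasureTheory

variable {V : Type*} [NormedAddCommGroup V] [InnerProductSpace ℝ V]

/-- One neuron averaged over a random input `y`. -/
noncomputable def avgNeuron {Ω : Type*} [MeasurableSpace Ω] (μ : Measure Ω) (y : Ω → V) (w : V) :
    ℝ :=
  ∫ ω, Real.sigmoid (inner ℝ w (y ω)) ∂μ

/-- The gradient of `avgNeuron μ y`. -/
noncomputable def avgNeuronGrad {Ω : Type*} [MeasurableSpace Ω] (μ : Measure Ω) (y : Ω → V)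
    (w : V) : V :=
  ∫ ω, sigmoidD (inner ℝ w (y ω)) • y ω ∂μ

lemma abs_inner_sub_inner_le (w x y : V) : |inner ℝ w x - inner ℝ w y| ≤ ‖w‖ * ‖x - y‖ := by
  rw [← inner_sub_right]; exact abs_real_inner_le_norm _ _

lemma hasFDerivAt_comp_inner {f : ℝ → ℝ} {f' : ℝ} {w x : V}
    (hf : HasDerivAt f f' (inner ℝ w x)) :
    HasFDerivAt (fun w => f (inner ℝ w x)) (f' • innerSL ℝ x) w := by
  have h1 : HasFDerivAt (fun w : V => inner ℝ w x) (innerSL ℝ x) w := by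
    have := (innerSL ℝ x).hasFDerivAt (x := w)
    convert! this using 1
    ext v; exact real_inner_comm _ _
  exact hf.comp_hasFDerivAt w h1

lemma hasGradientAt_comp_inner [CompleteSpace V] {f : ℝ → ℝ} {f' : ℝ} {w x : V}
    (hf : HasDerivAt f f' (inner ℝ w x)) :
    HasGradientAt (fun w => f (inner ℝ w x)) (f' • x) w := by
  rw [hasGradientAt_iff_hasFDerivAt]
  convert! hasFDerivAt_comp_inner hf using 1
  ext v; simp

/-- The single-neuron gradient, as a function of the weights, changes little when the input does. -/
lemma norm_grad_diff_sub_le {R B : ℝ} {c y : V} (hc : ‖c‖ ≤ B) {w v : V}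
    (hw : ‖w‖ ≤ R) (hv : ‖v‖ ≤ R) :
    ‖(sigmoidD (inner ℝ w y) • y - sigmoidD (inner ℝ w c) • c) -
      (sigmoidD (inner ℝ v y) • y - sigmoidD (inner ℝ v c) • c)‖ ≤
      (‖y - c‖ * (2 * B + ‖y - c‖) + R * ‖y - c‖ * B ^ 2) * ‖w - v‖ := by
  have hB : 0 ≤ B := (norm_nonneg c).trans hc
  have hR : 0 ≤ R := (norm_nonneg w).trans hw
  have hd : ∀ u ∈ Metric.closedBall (0 : V) R, HasFDerivWithinAt
      (fun w : V => sigmoidD (inner ℝ w y) • y - sigmoidD (inner ℝ w c) • c)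
      ((sigmoidD2 (inner ℝ u y) • innerSL ℝ y).smulRight y -
        (sigmoidD2 (inner ℝ u c) • innerSL ℝ c).smulRight c) (Metric.closedBall (0 : V) R) u := by
    intro u _
    exact (((hasFDerivAt_comp_inner (hasDerivAt_sigmoidD _)).smul_const y).sub
      ((hasFDerivAt_comp_inner (hasDerivAt_sigmoidD _)).smul_const c)).hasFDerivWithinAt
  refine Convex.norm_image_sub_le_of_norm_hasFDerivWithin_le hd (fun u hu => ?_)
    (convex_closedBall 0 R) (by simpa using hv) (by simpa using hw)
  have hu' : ‖u‖ ≤ R := by simpa using hu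
  refine ContinuousLinearMap.opNorm_le_bound _ (by positivity) fun z => ?_
  -- Every summand of the derivative carries the displacement `y - c` or the resulting change of
  -- `σ''`, hence a factor `‖y - c‖`.
  have key : ((sigmoidD2 (inner ℝ u y) • innerSL ℝ y).smulRight y -
        (sigmoidD2 (inner ℝ u c) • innerSL ℝ c).smulRight c) z =
      sigmoidD2 (inner ℝ u y) • (inner ℝ y z • (y - c) + inner ℝ (y - c) z • c) +
        (sigmoidD2 (inner ℝ u y) - sigmoidD2 (inner ℝ u c)) • (inner ℝ c z • c) := by
    simp only [sub_apply, ContinuousLinearMap.smulRight_apply,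
      smul_apply, innerSL_apply_apply, smul_eq_mul, inner_sub_left]
    module
  have hy : ‖y‖ ≤ B + ‖y - c‖ := by
    have := norm_add_le c (y - c); rw [add_sub_cancel] at this; linarith
  have h1 : ‖inner ℝ y z • (y - c) + inner ℝ (y - c) z • c‖ ≤
      ‖y - c‖ * (2 * B + ‖y - c‖) * ‖z‖ := by
    refine (norm_add_le _ _).trans ?_
    rw [norm_smul, norm_smul]
    have e1 := norm_inner_le_norm (𝕜 := ℝ) y z
    have e2 := norm_inner_le_norm (𝕜 := ℝ) (y - c) z
    calc _ ≤ (‖y‖ * ‖z‖) * ‖y - c‖ + (‖y - c‖ * ‖z‖) * ‖c‖ := by gcongr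
      _ ≤ ((B + ‖y - c‖) * ‖z‖) * ‖y - c‖ + (‖y - c‖ * ‖z‖) * B := by gcongr
      _ = _ := by ring
  have h2 : |sigmoidD2 (inner ℝ u y) - sigmoidD2 (inner ℝ u c)| ≤ R * ‖y - c‖ :=
    (abs_sub_le_of_hasDerivAt hasDerivAt_sigmoidD2 abs_sigmoidD3_le _ _).trans
      ((abs_inner_sub_inner_le u y c).trans (by gcongr))
  have h3 : ‖inner ℝ c z • c‖ ≤ B ^ 2 * ‖z‖ := by
    rw [norm_smul]
    have e1 := norm_inner_le_norm (𝕜 := ℝ) c z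
    calc _ ≤ (‖c‖ * ‖z‖) * ‖c‖ := by gcongr
      _ ≤ (B * ‖z‖) * B := by gcongr
      _ = _ := by ring
  rw [key]
  refine (norm_add_le _ _).trans ?_
  rw [norm_smul, norm_smul, Real.norm_eq_abs, Real.norm_eq_abs]
  calc _ ≤ 1 * (‖y - c‖ * (2 * B + ‖y - c‖) * ‖z‖) + (R * ‖y - c‖) * (B ^ 2 * ‖z‖) := by
        gcongr; exact abs_sigmoidD2_le _
    _ = _ := by ring

section avg

variable {Ω : Type*} [MeasurableSpace Ω] {μ : Measure Ω} {y : Ω → V}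

lemma integrable_sigmoid_inner [IsFiniteMeasure μ] (hy : AEStronglyMeasurable y μ) (w : V) :
    Integrable (fun ω => Real.sigmoid (inner ℝ w (y ω))) μ := by
  refine Integrable.of_bound (C := 1) ?_ (.of_forall fun ω => abs_sigmoid_le _)
  exact (continuous_sigmoid.comp (innerSL ℝ w).continuous).comp_aestronglyMeasurable hy

lemma integrable_sigmoidD_smul (hy : Integrable y μ) (w : V) :
    Integrable (fun ω => sigmoidD (inner ℝ w (y ω)) • y ω) μ := by
  have hc : Continuous sigmoidD :=
    continuous_iff_continuousAt.2 fun z => (hasDerivAt_sigmoidD z).continuousAt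
  refine hy.bdd_smul (C := 1) ?_ (.of_forall fun ω => abs_sigmoidD_le _)
  exact (hc.comp (innerSL ℝ w).continuous).comp_aestronglyMeasurable hy.1

variable [IsProbabilityMeasure μ]

/-- Differentiation under the integral, dominated by `‖y‖` because `|σ'| ≤ 1`. -/
lemma hasGradientAt_avgNeuron [CompleteSpace V] (hy : Integrable y μ) (w : V) :
    HasGradientAt (avgNeuron μ y) (avgNeuronGrad μ y w) w := by
  rw [hasGradientAt_iff_hasFDerivAt]
  have hint := integrable_sigmoidD_smul hy w
  have hL := (innerSL ℝ : V →L[ℝ] V →L[ℝ] ℝ).integrable_comp hint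
  have key : HasFDerivAt (fun w => ∫ ω, Real.sigmoid (inner ℝ w (y ω)) ∂μ)
      (∫ ω, innerSL ℝ (sigmoidD (inner ℝ w (y ω)) • y ω) ∂μ) w := by
    refine hasFDerivAt_integral_of_dominated_of_fderiv_le (bound := fun ω => ‖y ω‖)
      (F' := fun w ω => innerSL ℝ (sigmoidD (inner ℝ w (y ω)) • y ω))
      Filter.univ_mem (.of_forall fun v => (integrable_sigmoid_inner hy.1 v).1)
      (integrable_sigmoid_inner hy.1 w) hL.1 (.of_forall fun ω v _ => ?_) hy.norm
      (.of_forall fun ω v _ => ?_)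
    · rw [innerSL_apply_norm, norm_smul]
      exact mul_le_of_le_one_left (norm_nonneg _) (abs_sigmoidD_le _)
    · rw [map_smul]
      exact hasFDerivAt_comp_inner (hasDerivAt_sigmoid' _)
  convert! key using 1
  rw [avgNeuronGrad, ContinuousLinearMap.integral_comp_comm _ hint]
  rfl

variable {c : V} {B R δ : ℝ}

lemma abs_avgNeuron_le (w : V) : |avgNeuron μ y w| ≤ 1 := by
  simpa [avgNeuron] using norm_integral_le_of_norm_le_const (μ := μ) (C := 1)
    (f := fun ω => Real.sigmoid (inner ℝ w (y ω))) (.of_forall fun ω => abs_sigmoid_le _)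

lemma abs_avgNeuron_sub_le (hy : Integrable y μ) (hδ : ∫ ω, ‖y ω - c‖ ∂μ ≤ δ) {w : V}
    (hw : ‖w‖ ≤ R) : |avgNeuron μ y w - Real.sigmoid (inner ℝ w c)| ≤ R * δ := by
  have hyc : Integrable (fun ω => y ω - c) μ := hy.sub (integrable_const c)
  have hR : 0 ≤ R := (norm_nonneg w).trans hw
  have h : avgNeuron μ y w - Real.sigmoid (inner ℝ w c) =
      ∫ ω, (Real.sigmoid (inner ℝ w (y ω)) - Real.sigmoid (inner ℝ w c)) ∂μ := by
    rw [integral_sub (integrable_sigmoid_inner hy.1 w) (integrable_const _)]; simp [avgNeuron]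
  rw [h, ← Real.norm_eq_abs]
  calc _ ≤ ∫ ω, R * ‖y ω - c‖ ∂μ := norm_integral_le_of_norm_le (hyc.norm.const_mul R)
        (.of_forall fun ω => (abs_sub_le_of_hasDerivAt hasDerivAt_sigmoid' abs_sigmoidD_le _ _).trans
          ((abs_inner_sub_inner_le w _ c).trans (by gcongr)))
    _ ≤ R * δ := by rw [integral_const_mul]; gcongr

lemma avgNeuronGrad_sub [CompleteSpace V] (hy : Integrable y μ) (w : V) :
    avgNeuronGrad μ y w - sigmoidD (inner ℝ w c) • c =
      ∫ ω, (sigmoidD (inner ℝ w (y ω)) • y ω - sigmoidD (inner ℝ w c) • c) ∂μ := by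
  rw [integral_sub (integrable_sigmoidD_smul hy w) (integrable_const _)]; simp [avgNeuronGrad]

lemma norm_avgNeuronGrad_sub_le [CompleteSpace V] (hy : Integrable y μ) (hδ : ∫ ω, ‖y ω - c‖ ∂μ ≤ δ) (hc : ‖c‖ ≤ B)
    {w : V} (hw : ‖w‖ ≤ R) :
    ‖avgNeuronGrad μ y w - sigmoidD (inner ℝ w c) • c‖ ≤ (1 + R * B) * δ := by
  have hyc : Integrable (fun ω => y ω - c) μ := hy.sub (integrable_const c)
  have hR : 0 ≤ R := (norm_nonneg w).trans hw
  have hB : 0 ≤ B := (norm_nonneg c).trans hc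
  rw [avgNeuronGrad_sub hy]
  calc _ ≤ ∫ ω, (1 + R * B) * ‖y ω - c‖ ∂μ := by
        refine norm_integral_le_of_norm_le (hyc.norm.const_mul _) (.of_forall fun ω => ?_)
        have e : sigmoidD (inner ℝ w (y ω)) • y ω - sigmoidD (inner ℝ w c) • c =
          sigmoidD (inner ℝ w (y ω)) • (y ω - c) +
            (sigmoidD (inner ℝ w (y ω)) - sigmoidD (inner ℝ w c)) • c := by module
        have h2 : |sigmoidD (inner ℝ w (y ω)) - sigmoidD (inner ℝ w c)| ≤ R * ‖y ω - c‖ :=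
          (abs_sub_le_of_hasDerivAt hasDerivAt_sigmoidD abs_sigmoidD2_le _ _).trans
            ((abs_inner_sub_inner_le w _ c).trans (by gcongr))
        rw [e]
        refine (norm_add_le _ _).trans ?_
        rw [norm_smul, norm_smul, Real.norm_eq_abs, Real.norm_eq_abs]
        calc _ ≤ 1 * ‖y ω - c‖ + R * ‖y ω - c‖ * B := by gcongr; exact abs_sigmoidD_le _
          _ = _ := by ring
    _ ≤ (1 + R * B) * δ := by rw [integral_const_mul]; gcongr

/-- `norm_grad_diff_sub_le` is integrated over the input. Its bound is quadratic in the
displacement, hence the second moment. -/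
lemma norm_avgNeuronGrad_sub_sub_le [CompleteSpace V] (hy : Integrable y μ)
    (hy2 : Integrable (fun ω => ‖y ω - c‖ ^ 2) μ) (hδ : ∫ ω, ‖y ω - c‖ ∂μ ≤ δ)
    (hδ2 : ∫ ω, ‖y ω - c‖ ^ 2 ∂μ ≤ δ ^ 2) (hc : ‖c‖ ≤ B) {w v : V}
    (hw : ‖w‖ ≤ R) (hv : ‖v‖ ≤ R) :
    ‖(avgNeuronGrad μ y w - sigmoidD (inner ℝ w c) • c) -
      (avgNeuronGrad μ y v - sigmoidD (inner ℝ v c) • c)‖ ≤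
      (2 * B * δ + δ ^ 2 + R * B ^ 2 * δ) * ‖w - v‖ := by
  have hyc : Integrable (fun ω => y ω - c) μ := hy.sub (integrable_const c)
  have hR : 0 ≤ R := (norm_nonneg w).trans hw
  have hB : 0 ≤ B := (norm_nonneg c).trans hc
  have hi : ∀ w : V, Integrable
      (fun ω => sigmoidD (inner ℝ w (y ω)) • y ω - sigmoidD (inner ℝ w c) • c) μ :=
    fun w => (integrable_sigmoidD_smul hy w).sub (integrable_const _)
  rw [avgNeuronGrad_sub hy, avgNeuronGrad_sub hy, ← integral_sub (hi w) (hi v)]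
  have hI1 : Integrable (fun ω => (2 * B + R * B ^ 2) * ‖w - v‖ * ‖y ω - c‖) μ :=
    hyc.norm.const_mul _
  have hI2 : Integrable (fun ω => ‖w - v‖ * ‖y ω - c‖ ^ 2) μ := hy2.const_mul _
  calc _ ≤ ∫ ω, ((2 * B + R * B ^ 2) * ‖w - v‖ * ‖y ω - c‖ + ‖w - v‖ * ‖y ω - c‖ ^ 2) ∂μ := by
        refine norm_integral_le_of_norm_le (hI1.add hI2) (.of_forall fun ω => ?_)
        refine (norm_grad_diff_sub_le hc hw hv).trans_eq ?_
        ring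
    _ = (2 * B + R * B ^ 2) * ‖w - v‖ * ∫ ω, ‖y ω - c‖ ∂μ + ‖w - v‖ * ∫ ω, ‖y ω - c‖ ^ 2 ∂μ := by
        rw [integral_add hI1 hI2, integral_const_mul, integral_const_mul]
    _ ≤ (2 * B + R * B ^ 2) * ‖w - v‖ * δ + ‖w - v‖ * δ ^ 2 := by gcongr
    _ = _ := by ring

variable [CompleteSpace V]

/-- Averaging over an input close to `c` hardly changes the gradient of the squared neuron. -/
lemma norm_sq_avgNeuron_grad_sub_le (hy : Integrable y μ) (hδ : ∫ ω, ‖y ω - c‖ ∂μ ≤ δ)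
    (hc : ‖c‖ ≤ B) (hB : 1 ≤ B) (hR : 1 ≤ R) {w : V} (hw : ‖w‖ ≤ R) :
    ‖(2 * avgNeuron μ y w) • avgNeuronGrad μ y w - sqSigmoidD (inner ℝ w c) • c‖ ≤
      8 * R * B * δ := by
  have h1 := abs_avgNeuron_sub_le hy hδ hw
  have h2 := norm_avgNeuronGrad_sub_le hy hδ hc hw
  have hδ0 : 0 ≤ δ := (integral_nonneg fun ω => norm_nonneg _).trans hδ
  have h3 : ‖sigmoidD (inner ℝ w c) • c‖ ≤ B := by
    rw [norm_smul]
    exact (mul_le_of_le_one_left (norm_nonneg _) (abs_sigmoidD_le _)).trans hc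
  have e : (2 * avgNeuron μ y w) • avgNeuronGrad μ y w - sqSigmoidD (inner ℝ w c) • c =
      (2 * avgNeuron μ y w) • (avgNeuronGrad μ y w - sigmoidD (inner ℝ w c) • c) +
        (2 * (avgNeuron μ y w - Real.sigmoid (inner ℝ w c))) • sigmoidD (inner ℝ w c) • c := by
    simp only [sqSigmoidD]; module
  rw [e]
  refine (norm_add_le _ _).trans ?_
  rw [norm_smul, norm_smul, norm_mul, norm_mul, Real.norm_ofNat, Real.norm_eq_abs, Real.norm_eq_abs]
  have h4 := abs_avgNeuron_le (μ := μ) (y := y) w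
  calc _ ≤ 2 * 1 * ((1 + R * B) * δ) + 2 * (R * δ) * B := by gcongr
    _ ≤ 8 * R * B * δ := by
      have : 1 ≤ R * B := one_le_mul_of_one_le_of_one_le hR hB
      nlinarith

/-- Averaging over an input close to `c` perturbs the gradient of the squared neuron by a map
with a small Lipschitz constant. -/
lemma norm_sq_avgNeuron_grad_sub_sub_le (hy : Integrable y μ)
    (hy2 : Integrable (fun ω => ‖y ω - c‖ ^ 2) μ) (hδ : ∫ ω, ‖y ω - c‖ ∂μ ≤ δ)
    (hδ2 : ∫ ω, ‖y ω - c‖ ^ 2 ∂μ ≤ δ ^ 2)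
    (hδ1 : R * δ ≤ 1) (hc : ‖c‖ ≤ B) (hB : 1 ≤ B) (hR : 1 ≤ R) {w v : V} (hw : ‖w‖ ≤ R)
    (hv : ‖v‖ ≤ R) :
    ‖((2 * avgNeuron μ y w) • avgNeuronGrad μ y w - sqSigmoidD (inner ℝ w c) • c) -
      ((2 * avgNeuron μ y v) • avgNeuronGrad μ y v - sqSigmoidD (inner ℝ v c) • c)‖ ≤
      30 * R * B ^ 2 * δ * ‖w - v‖ := by
  have hδ0 : 0 ≤ δ := (integral_nonneg fun ω => norm_nonneg _).trans hδ
  have hRB : 1 ≤ R * B := one_le_mul_of_one_le_of_one_le hR hB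
  have hBc : ‖c‖ ^ 2 ≤ B ^ 2 := by gcongr
  set φ := avgNeuron μ y
  set ψ := avgNeuronGrad μ y
  set σw := Real.sigmoid (inner ℝ w c)
  set σv := Real.sigmoid (inner ℝ v c)
  set tw := sigmoidD (inner ℝ w c)
  set tv := sigmoidD (inner ℝ v c)
  have hφ : |φ w| ≤ 1 := abs_avgNeuron_le w
  -- Mean value inequality on the ball of radius `R`: the gradient of `φ - σ` is already bounded
  -- there.
  have h1 : |(φ w - σw) - (φ v - σv)| ≤ (1 + R * B) * δ * ‖w - v‖ := by
    have hd : ∀ u ∈ Metric.closedBall (0 : V) R, HasFDerivWithinAt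
        (fun w : V => φ w - Real.sigmoid (inner ℝ w c))
        (innerSL ℝ (ψ u - sigmoidD (inner ℝ u c) • c)) (Metric.closedBall (0 : V) R) u := by
      intro u _
      have e1 := (hasGradientAt_iff_hasFDerivAt.1 (hasGradientAt_avgNeuron hy u))
      have e2 := (hasGradientAt_iff_hasFDerivAt.1
        (hasGradientAt_comp_inner (x := c) (w := u) (hasDerivAt_sigmoid' _)))
      refine ((e1.sub e2).congr_fderiv ?_).hasFDerivWithinAt
      ext z; simp [ψ]
    refine Convex.norm_image_sub_le_of_norm_hasFDerivWithin_le hd (fun u hu => ?_)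
      (convex_closedBall 0 R) (by simpa using hv) (by simpa using hw)
    rw [innerSL_apply_norm]
    exact norm_avgNeuronGrad_sub_le hy hδ hc (by simpa using hu)
  have h2 : |φ v - σv| ≤ R * δ := abs_avgNeuron_sub_le hy hδ hv
  have h3 : ‖ψ v - tv • c‖ ≤ (1 + R * B) * δ := norm_avgNeuronGrad_sub_le hy hδ hc hv
  have h4 : ‖(ψ w - tw • c) - (ψ v - tv • c)‖ ≤ (2 * B * δ + δ ^ 2 + R * B ^ 2 * δ) * ‖w - v‖ :=
    norm_avgNeuronGrad_sub_sub_le hy hy2 hδ hδ2 hc hw hv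
  have h5 : |inner ℝ w c - inner ℝ v c| ≤ B * ‖w - v‖ := by
    rw [← inner_sub_left, mul_comm]
    exact (abs_real_inner_le_norm _ _).trans (by gcongr)
  have h6 : |σw - σv| ≤ B * ‖w - v‖ :=
    (abs_sub_le_of_hasDerivAt hasDerivAt_sigmoid' abs_sigmoidD_le _ _).trans h5
  have h7 : |tw - tv| ≤ B * ‖w - v‖ :=
    (abs_sub_le_of_hasDerivAt hasDerivAt_sigmoidD abs_sigmoidD2_le _ _).trans h5
  have h8 : |tw| ≤ 1 := abs_sigmoidD_le _
  -- Product rule for differences: each of the five terms contains one of the errors `φ - σ`, `ψ -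
  -- σ' c` or an increment of them, while another factor supplies `‖w - v‖`.
  have e : ((2 * φ w) • ψ w - sqSigmoidD (inner ℝ w c) • c) -
      ((2 * φ v) • ψ v - sqSigmoidD (inner ℝ v c) • c) =
      (2 : ℝ) • (φ w • ((ψ w - tw • c) - (ψ v - tv • c)) +
        ((φ w - σw) - (φ v - σv)) • (ψ v - tv • c) + (σw - σv) • (ψ v - tv • c) +
        ((φ w - σw) - (φ v - σv)) • tw • c + ((φ v - σv) * (tw - tv)) • c) := by
    simp only [sqSigmoidD]
    change ((2 * φ w) • ψ w - (2 * σw * tw) • c) - ((2 * φ v) • ψ v - (2 * σv * tv) • c) = _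
    module
  rw [e, norm_smul, Real.norm_ofNat]
  have hb : ‖φ w • ((ψ w - tw • c) - (ψ v - tv • c)) +
        ((φ w - σw) - (φ v - σv)) • (ψ v - tv • c) + (σw - σv) • (ψ v - tv • c) +
        ((φ w - σw) - (φ v - σv)) • tw • c + ((φ v - σv) * (tw - tv)) • c‖ ≤
      1 * ((2 * B * δ + δ ^ 2 + R * B ^ 2 * δ) * ‖w - v‖) +
        ((1 + R * B) * δ * ‖w - v‖) * ((1 + R * B) * δ) + (B * ‖w - v‖) * ((1 + R * B) * δ) +
        ((1 + R * B) * δ * ‖w - v‖) * (1 * B) + (R * δ) * (B * ‖w - v‖) * B := by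
    refine (norm_add_le _ _).trans (add_le_add ((norm_add_le _ _).trans (add_le_add
      ((norm_add_le _ _).trans (add_le_add ((norm_add_le _ _).trans (add_le_add ?_ ?_)) ?_)) ?_)) ?_)
    all_goals simp only [norm_smul, norm_mul, Real.norm_eq_abs]
    all_goals gcongr
  set p := ‖w - v‖
  have hp : 0 ≤ p := norm_nonneg _
  have hδ1' : δ ≤ 1 := (le_mul_of_one_le_left hδ0 hR).trans hδ1
  have hq : 1 + R * B ≤ 2 * (R * B) := by linarith
  have hx : B ≤ R * B ^ 2 := by nlinarith
  have hy1 : 1 ≤ R * B ^ 2 := hB.trans hx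
  have t1 : 2 * B * δ + δ ^ 2 + R * B ^ 2 * δ ≤ 4 * (R * B ^ 2 * δ) := by
    have : δ ^ 2 ≤ δ := by nlinarith
    nlinarith
  have t2 : (1 + R * B) * δ ≤ 2 * (R * B) * δ := by gcongr
  -- `R δ ≤ 1` keeps terms quadratic in the error linear in `δ`.
  have t3 : (1 + R * B) * δ ≤ 2 * B := by
    nlinarith
  have t0 : 0 ≤ (1 + R * B) * δ := by positivity
  have t4 : ((1 + R * B) * δ * p) * ((1 + R * B) * δ) ≤ 2 * (R * B) * δ * p * (2 * B) := by
    gcongr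
  have t5 : (B * p) * ((1 + R * B) * δ) ≤ (B * p) * (2 * (R * B) * δ) := by gcongr
  have t6 : ((1 + R * B) * δ * p) * (1 * B) ≤ (2 * (R * B) * δ * p) * (1 * B) := by gcongr
  have t7 := mul_le_mul_of_nonneg_right t1 hp
  have t8 : 0 ≤ R * B ^ 2 * δ * p := by positivity
  linarith

end avg

end SSL

/-! ### Splitting the losses into single-neuron losses, and their gradients. -/

namespace SSL
open MeasureTheory ProbabilityTheory

variable {d n : ℕ}

instance isProbabilityMeasure_augLaw (ρ : ℝ) : IsProbabilityMeasure (augLaw d ρ) :=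
  Measure.isProbabilityMeasure_map (by fun_prop)

lemma memLp_two_id_augLaw (ρ : ℝ) : MemLp id 2 (augLaw d ρ) := by
  rw [augLaw, memLp_map_measure_iff (by fun_prop) (by fun_prop)]
  exact (IsGaussian.memLp_two_id (μ := stdGaussian (Vec d))).const_smul ρ

lemma integrable_add_augLaw (ρ : ℝ) (x : Vec d) : Integrable (fun ξ => x + ξ) (augLaw d ρ) :=
  (integrable_const x).add ((memLp_two_id_augLaw ρ).integrable one_le_two)

/-- The contribution of one neuron to the objective `loss`. -/
noncomputable def neuronLoss (α τ ρ : ℝ) (S : Sample d n) (w : Vec d) : ℝ :=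
  α * ‖w‖ ^ 2 - (1 / (n : ℝ)) *
    ∑ i : Fin n, avgNeuron (augLaw d ρ) (fun ξ => datapoint τ ρ S i + ξ) w ^ 2

/-- The gradient of `neuronLoss`. -/
noncomputable def neuronGrad (α τ ρ : ℝ) (S : Sample d n) (w : Vec d) : Vec d :=
  (2 * α) • w - (1 / (n : ℝ)) •
    ∑ i : Fin n, (2 * avgNeuron (augLaw d ρ) (fun ξ => datapoint τ ρ S i + ξ) w) •
      avgNeuronGrad (augLaw d ρ) (fun ξ => datapoint τ ρ S i + ξ) w

/-- The contribution of one neuron to the objective `noiseFreeLoss`. -/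
noncomputable def noiseFreeNeuronLoss (d : ℕ) (α τ : ℝ) (w : Vec d) : ℝ :=
  α * ‖w‖ ^ 2 - (1 / 4) * ∑ c : Fin 4, Real.sigmoid (inner ℝ w (center d τ c)) ^ 2

/-- The gradient of `noiseFreeNeuronLoss`. -/
noncomputable def noiseFreeNeuronGrad (d : ℕ) (α τ : ℝ) (w : Vec d) : Vec d :=
  (2 * α) • w - (1 / 4 : ℝ) •
    ∑ c : Fin 4, sqSigmoidD (inner ℝ w (center d τ c)) • center d τ c

lemma norm_sq_weights (W : Weights d) : ‖W‖ ^ 2 = ‖W 0‖ ^ 2 + ‖W 1‖ ^ 2 := by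
  rw [PiLp.norm_sq_eq_of_L2, Fin.sum_univ_two]

lemma inner_encode (W : Weights d) (x y : Vec d) : inner ℝ (encode W x) (encode W y) =
    Real.sigmoid (inner ℝ (W 0) x) * Real.sigmoid (inner ℝ (W 0) y) +
      Real.sigmoid (inner ℝ (W 1) x) * Real.sigmoid (inner ℝ (W 1) y) := by
  simp only [encode, PiLp.inner_apply, Fin.sum_univ_two, RCLike.inner_apply, conj_trivial]
  ring

/-- For each datapoint the integrand is a sum over rows of products of a function of `ξ` and the
same function of `ξ'`; independence turns each integral into a square. -/
lemma loss_eq_add (α τ ρ : ℝ) (S : Sample d n) (W : Weights d) :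
    loss α τ ρ S W = neuronLoss α τ ρ S (W 0) + neuronLoss α τ ρ S (W 1) := by
  have h : ∀ i : Fin n, ∫ ξ : Vec d × Vec d,
      inner ℝ (encode W (datapoint τ ρ S i + ξ.1)) (encode W (datapoint τ ρ S i + ξ.2))
      ∂((augLaw d ρ).prod (augLaw d ρ)) =
      avgNeuron (augLaw d ρ) (fun ξ => datapoint τ ρ S i + ξ) (W 0) ^ 2 +
        avgNeuron (augLaw d ρ) (fun ξ => datapoint τ ρ S i + ξ) (W 1) ^ 2 := by
    intro i
    have hi : ∀ w : Vec d, Integrable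
        (fun ξ => Real.sigmoid (inner ℝ w (datapoint τ ρ S i + ξ))) (augLaw d ρ) := fun w =>
      integrable_sigmoid_inner (integrable_add_augLaw ρ _).1 w
    simp only [inner_encode]
    rw [integral_add ((hi (W 0)).mul_prod (hi (W 0))) ((hi (W 1)).mul_prod (hi (W 1))),
      integral_prod_mul (fun ξ => Real.sigmoid (inner ℝ (W 0) (datapoint τ ρ S i + ξ)))
        (fun ξ => Real.sigmoid (inner ℝ (W 0) (datapoint τ ρ S i + ξ))),
      integral_prod_mul (fun ξ => Real.sigmoid (inner ℝ (W 1) (datapoint τ ρ S i + ξ)))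
        (fun ξ => Real.sigmoid (inner ℝ (W 1) (datapoint τ ρ S i + ξ)))]
    simp only [avgNeuron]; ring
  simp only [loss, h, Finset.sum_add_distrib, neuronLoss, norm_sq_weights]
  ring

lemma noiseFreeLoss_eq_add (α τ : ℝ) (W : Weights d) : noiseFreeLoss d α τ W =
    noiseFreeNeuronLoss d α τ (W 0) + noiseFreeNeuronLoss d α τ (W 1) := by
  rw [noiseFreeLoss, norm_sq_weights]
  simp only [inner_encode, Finset.sum_add_distrib, noiseFreeNeuronLoss, sq]
  ring

section gradient

variable {V : Type*} [NormedAddCommGroup V] [InnerProductSpace ℝ V] [CompleteSpace V]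

lemma _root_.HasGradientAt.sub {f g : V → ℝ} {f' g' x : V} (hf : HasGradientAt f f' x)
    (hg : HasGradientAt g g' x) : HasGradientAt (fun y => f y - g y) (f' - g') x := by
  rw [hasGradientAt_iff_hasFDerivAt] at *
  rw [map_sub]; exact hf.sub hg

lemma _root_.HasGradientAt.const_mul {f : V → ℝ} {f' x : V} (c : ℝ) (hf : HasGradientAt f f' x) :
    HasGradientAt (fun y => c * f y) (c • f') x := by
  rw [hasGradientAt_iff_hasFDerivAt] at *
  rw [map_smulₛₗ]; exact hf.const_mul c

lemma _root_.HasGradientAt.fun_sum {ι : Type*} {s : Finset ι} {f : ι → V → ℝ} {f' : ι → V} {x : V}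
    (hf : ∀ i ∈ s, HasGradientAt (f i) (f' i) x) :
    HasGradientAt (fun y => ∑ i ∈ s, f i y) (∑ i ∈ s, f' i) x := by
  simp only [hasGradientAt_iff_hasFDerivAt] at *
  rw [map_sum]; exact HasFDerivAt.fun_sum hf

lemma _root_.HasGradientAt.pow_two {f : V → ℝ} {f' x : V} (hf : HasGradientAt f f' x) :
    HasGradientAt (fun y => f y ^ 2) ((2 * f x) • f') x := by
  rw [hasGradientAt_iff_hasFDerivAt] at *
  rw [map_smulₛₗ]; simpa using hf.pow 2

lemma hasGradientAt_norm_sq (x : V) : HasGradientAt (fun y : V => ‖y‖ ^ 2) ((2 : ℝ) • x) x := by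
  rw [hasGradientAt_iff_hasFDerivAt]
  refine (hasStrictFDerivAt_norm_sq x).hasFDerivAt.congr_fderiv ?_
  ext z; simp

end gradient

lemma hasGradientAt_neuronLoss (α τ ρ : ℝ) (S : Sample d n) (w : Vec d) :
    HasGradientAt (neuronLoss α τ ρ S) (neuronGrad α τ ρ S w) w := by
  convert! ((hasGradientAt_norm_sq w).const_mul α).sub ((HasGradientAt.fun_sum
    (s := Finset.univ) fun i _ => (hasGradientAt_avgNeuron (integrable_add_augLaw ρ
      (datapoint τ ρ S i)) w).pow_two).const_mul (1 / (n : ℝ))) using 1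
  rw [neuronGrad, smul_smul, mul_comm α]

lemma hasGradientAt_noiseFreeNeuronLoss (α τ : ℝ) (w : Vec d) :
    HasGradientAt (noiseFreeNeuronLoss d α τ) (noiseFreeNeuronGrad d α τ w) w := by
  convert! ((hasGradientAt_norm_sq w).const_mul α).sub ((HasGradientAt.fun_sum
    (s := Finset.univ) fun c _ => hasGradientAt_comp_inner (x := center d τ c)
      (hasDerivAt_sq_sigmoid (inner ℝ w (center d τ c)))).const_mul (1 / 4)) using 1
  rw [noiseFreeNeuronGrad, smul_smul, mul_comm α]

/-- The gradient of a sum of functions of the single rows. -/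
lemma hasGradientAt_rows {f : Vec d → ℝ} {g : Vec d → Vec d} (hf : ∀ w, HasGradientAt f (g w) w)
    (W : Weights d) : HasGradientAt (fun W : Weights d => f (W 0) + f (W 1))
      (WithLp.toLp 2 fun j => g (W j)) W := by
  have h : ∀ j : Fin 2, HasFDerivAt (fun W : Weights d => f (W j))
      ((InnerProductSpace.toDual ℝ (Vec d) (g (W j))).comp
        (PiLp.proj 2 (fun _ : Fin 2 => Vec d) j : Weights d →L[ℝ] Vec d)) W := fun j =>
    (hasGradientAt_iff_hasFDerivAt.1 (hf (W j))).comp W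
      (PiLp.proj 2 (fun _ : Fin 2 => Vec d) j : Weights d →L[ℝ] Vec d).hasFDerivAt
  rw [hasGradientAt_iff_hasFDerivAt]
  refine ((h 0).add (h 1)).congr_fderiv ?_
  ext Z
  simp [PiLp.inner_apply]

lemma hasGradientAt_loss (α τ ρ : ℝ) (S : Sample d n) (W : Weights d) :
    HasGradientAt (loss α τ ρ S) (WithLp.toLp 2 fun j => neuronGrad α τ ρ S (W j)) W := by
  convert! hasGradientAt_rows (hasGradientAt_neuronLoss α τ ρ S) W using 1
  exact funext (loss_eq_add α τ ρ S)

lemma isLocalMin_rows {f : Vec d → ℝ} {W : Weights d} (h0 : IsLocalMin f (W 0))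
    (h1 : IsLocalMin f (W 1)) : IsLocalMin (fun W : Weights d => f (W 0) + f (W 1)) W := by
  have hc : ∀ j : Fin 2, Filter.Tendsto (fun W : Weights d => W j) (nhds W) (nhds (W j)) :=
    fun j => (PiLp.continuous_apply 2 (fun _ : Fin 2 => Vec d) j).tendsto W
  filter_upwards [(hc 0).eventually h0, (hc 1).eventually h1] with Z hZ0 hZ1
  exact add_le_add hZ0 hZ1

lemma isLocalMin_loss {α τ ρ : ℝ} {S : Sample d n} {W : Weights d}
    (h0 : IsLocalMin (neuronLoss α τ ρ S) (W 0)) (h1 : IsLocalMin (neuronLoss α τ ρ S) (W 1)) :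
    IsLocalMin (loss α τ ρ S) W := by
  rw [funext (loss_eq_add α τ ρ S)]; exact isLocalMin_rows h0 h1

lemma isLocalMin_noiseFreeLoss {α τ : ℝ} {W : Weights d}
    (h0 : IsLocalMin (noiseFreeNeuronLoss d α τ) (W 0))
    (h1 : IsLocalMin (noiseFreeNeuronLoss d α τ) (W 1)) :
    IsLocalMin (noiseFreeLoss d α τ) W := by
  rw [funext (noiseFreeLoss_eq_add α τ)]; exact isLocalMin_rows h0 h1

lemma gradient_eq_zero_of_isLocalMin {V : Type*} [NormedAddCommGroup V] [InnerProductSpace ℝ V]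
    [CompleteSpace V] {f : V → ℝ} {g x : V} (h : IsLocalMin f x) (hg : HasGradientAt f g x) :
    g = 0 := by
  have := h.hasFDerivAt_eq_zero (hasGradientAt_iff_hasFDerivAt.1 hg)
  simpa using this

lemma hasGradientAt_noiseFreeLoss_zero {α τ : ℝ} {W : Weights d}
    (h : IsLocalMin (noiseFreeLoss d α τ) W) : HasGradientAt (noiseFreeLoss d α τ) 0 W := by
  have h1 : HasGradientAt (noiseFreeLoss d α τ)
      (WithLp.toLp 2 fun j => noiseFreeNeuronGrad d α τ (W j)) W := by
    convert! hasGradientAt_rows (hasGradientAt_noiseFreeNeuronLoss α τ) W using 1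
    exact funext (noiseFreeLoss_eq_add α τ)
  rwa [gradient_eq_zero_of_isLocalMin h h1] at h1

/-- Gradient descent on `loss` is gradient descent on each neuron. -/
lemma IsGradientDescent.neuron {α τ ρ η : ℝ} {S : Sample d n} {W : ℕ → Weights d}
    (h : IsGradientDescent (loss α τ ρ S) η W) (j : Fin 2) (t : ℕ) :
    W (t + 1) j = W t j - η • neuronGrad α τ ρ S (W t j) := by
  rw [h t, (hasGradientAt_loss α τ ρ S (W t)).gradient]; rfl

end SSL

/-! ### Coordinates and convexity of the noise-free loss on the good region. -/

namespace SSL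

variable {d : ℕ}

lemma inner_stdVec (w : Vec d) (k : ℕ) : inner ℝ w (stdVec d k) = coord w k := by
  simp only [stdVec, coord, PiLp.inner_apply, RCLike.inner_apply, conj_trivial, ite_mul, one_mul,
    zero_mul]
  split_ifs with h
  · rw [Finset.sum_eq_single (⟨k, h⟩ : Fin d)]
    · simp
    · intro i _ hi
      rw [if_neg fun h' => hi (Fin.ext h')]
    · simp
  · exact Finset.sum_eq_zero fun i _ => if_neg fun h' : (i : ℕ) = k => h (h' ▸ i.2)

lemma coord_add (x y : Vec d) (k : ℕ) : coord (x + y) k = coord x k + coord y k := by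
  simp [← inner_stdVec, inner_add_left]

lemma coord_sub (x y : Vec d) (k : ℕ) : coord (x - y) k = coord x k - coord y k := by
  simp [← inner_stdVec, inner_sub_left]

lemma coord_neg (x : Vec d) (k : ℕ) : coord (-x) k = -coord x k := by
  simp [← inner_stdVec]

lemma coord_smul (c : ℝ) (x : Vec d) (k : ℕ) : coord (c • x) k = c * coord x k := by
  simp [← inner_stdVec, real_inner_smul_left]

lemma coord_stdVec {j : ℕ} (hj : j < d) (k : ℕ) :
    coord (stdVec d k) j = if j = k then 1 else 0 := by
  simp [coord, stdVec, hj]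

lemma norm_stdVec_le (k : ℕ) : ‖stdVec d k‖ ≤ 1 := by
  have h : ‖stdVec d k‖ ^ 2 ≤ 1 := by
    rw [← real_inner_self_eq_norm_sq, inner_stdVec]
    simp only [coord, stdVec]
    split_ifs <;> norm_num
  nlinarith [norm_nonneg (stdVec d k)]

lemma norm_stdVec {k : ℕ} (hk : k < d) : ‖stdVec d k‖ = 1 := by
  have h : ‖stdVec d k‖ ^ 2 = 1 := by
    rw [← real_inner_self_eq_norm_sq, inner_stdVec, coord_stdVec hk, if_pos rfl]
  nlinarith [norm_nonneg (stdVec d k)]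

lemma abs_coord_le (x : Vec d) (k : ℕ) : |coord x k| ≤ ‖x‖ := by
  rw [← inner_stdVec]
  exact (abs_real_inner_le_norm _ _).trans
    (mul_le_of_le_one_right (norm_nonneg _) (norm_stdVec_le k))

lemma inner_center (w : Vec d) (τ : ℝ) (c : Fin 4) : inner ℝ w (center d τ c) =
    ![coord w 0, coord w 0 + τ * coord w 1, -coord w 0, -coord w 0 + τ * coord w 1] c := by
  fin_cases c <;> simp [center, inner_add_right, real_inner_smul_right, inner_stdVec]

lemma norm_center_le {τ : ℝ} (hτ : 0 ≤ τ) (c : Fin 4) : ‖center d τ c‖ ≤ 1 + τ := by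
  have h0 := norm_stdVec_le (d := d) 0
  have h1 : ‖τ • stdVec d 1‖ ≤ τ := by
    rw [norm_smul, Real.norm_of_nonneg hτ]
    exact mul_le_of_le_one_right hτ (norm_stdVec_le 1)
  fin_cases c
  · exact h0.trans (by linarith)
  · exact (norm_add_le _ _).trans (add_le_add h0 h1)
  · change ‖-stdVec d 0‖ ≤ _
    rw [norm_neg]; linarith
  · refine (norm_add_le _ _).trans (add_le_add ?_ h1)
    rwa [norm_neg]

/-- The part of the noise-free gradient in the direction of the first coordinate, for the weights
`a` and `b = s / τ` in the first two coordinates. -/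
noncomputable def firstForce (a s : ℝ) : ℝ :=
  a / 100 - (sqSigmoidD a - sqSigmoidD (-a) + sqSigmoidD (s + a) - sqSigmoidD (s - a))

lemma firstForce_neg (a s : ℝ) : firstForce (-a) s = -firstForce a s := by
  simp only [firstForce, neg_neg, sub_neg_eq_add, ← sub_eq_add_neg]; ring

lemma noiseFreeNeuronGrad_eq (τ : ℝ) (w : Vec d) : noiseFreeNeuronGrad d (1 / 800) τ w =
    (1 / 400 : ℝ) • w - (1 / 4 : ℝ) •
      ((sqSigmoidD (coord w 0) - sqSigmoidD (-coord w 0)) • stdVec d 0 +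
        sqSigmoidD (τ * coord w 1 + coord w 0) • (stdVec d 0 + τ • stdVec d 1) +
        sqSigmoidD (τ * coord w 1 - coord w 0) • (-stdVec d 0 + τ • stdVec d 1)) := by
  simp only [noiseFreeNeuronGrad, Fin.sum_univ_four, inner_center]
  simp only [center, Matrix.cons_val]
  rw [add_comm (coord w 0), neg_add_eq_sub]
  module

lemma coord_zero_noiseFreeNeuronGrad (hd : 2 ≤ d) (τ : ℝ) (w : Vec d) :
    coord (noiseFreeNeuronGrad d (1 / 800) τ w) 0 =
      firstForce (coord w 0) (τ * coord w 1) / 4 := by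
  have h0 : 0 < d := by lia
  simp only [noiseFreeNeuronGrad_eq, coord_sub, coord_smul, coord_add, coord_neg,
    coord_stdVec h0, firstForce]
  norm_num; ring

lemma coord_one_noiseFreeNeuronGrad (hd : 2 ≤ d) (τ : ℝ) (w : Vec d) :
    coord (noiseFreeNeuronGrad d (1 / 800) τ w) 1 = coord w 1 / 400 - τ / 4 *
      (sqSigmoidD (τ * coord w 1 + coord w 0) + sqSigmoidD (τ * coord w 1 - coord w 0)) := by
  have h0 : 1 < d := by lia
  simp only [noiseFreeNeuronGrad_eq, coord_sub, coord_smul, coord_add, coord_neg,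
    coord_stdVec h0]
  norm_num; ring

/-- The weights of a neuron around the minimizers of `noiseFreeLoss`: the first coordinate has
modulus in `[3, 4]` and sign `ς`, the second one is large, and the norm is at most `R`. -/
def goodRegion (d : ℕ) (τ R ς : ℝ) : Set (Vec d) :=
  {w | ς * coord w 0 ∈ Set.Icc 3 4 ∧ 8 ≤ τ * coord w 1 ∧ ‖w‖ ≤ R}

section rankOne

variable {V ι : Type*} [NormedAddCommGroup V] [InnerProductSpace ℝ V] [Fintype ι]

lemma inner_sum_inner_smul (k : ι → ℝ) (c : ι → V) (z : V) :
    inner ℝ (∑ i, (k i * inner ℝ (c i) z) • c i) z = ∑ i, k i * inner ℝ (c i) z ^ 2 := by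
  rw [sum_inner]
  refine Finset.sum_congr rfl fun i _ => ?_
  rw [real_inner_smul_left]; ring

/-- Cauchy–Schwarz with weights `k i`. This cocoercivity of a sum of rank-one forms replaces a bound
on the largest eigenvalue of a Hessian. -/
lemma norm_sum_inner_smul_sq_le {k : ι → ℝ} (hk : ∀ i, 0 ≤ k i) (c : ι → V) (z : V) :
    ‖∑ i, (k i * inner ℝ (c i) z) • c i‖ ^ 2 ≤
      (∑ i, k i * ‖c i‖ ^ 2) * ∑ i, k i * inner ℝ (c i) z ^ 2 := by
  have h1 : ‖∑ i, (k i * inner ℝ (c i) z) • c i‖ ≤ ∑ i, k i * |inner ℝ (c i) z| * ‖c i‖ := by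
    refine (norm_sum_le _ _).trans_eq (Finset.sum_congr rfl fun i _ => ?_)
    rw [norm_smul, norm_mul, Real.norm_of_nonneg (hk i), Real.norm_eq_abs]
  refine (pow_le_pow_left₀ (norm_nonneg _) h1 2).trans ?_
  refine Finset.sum_sq_le_sum_mul_sum_of_sq_le_mul _ (fun i _ => ?_) (fun i _ => ?_) fun i _ => ?_
  · have := hk i; positivity
  · have := hk i; positivity
  · rw [mul_pow, mul_pow, sq_abs]; exact le_of_eq (by ring)

/-- One step of gradient descent on a quadratic function, with Hessian `m + B`, contracts. -/
lemma norm_sub_smul_le {m η M : ℝ} (hη : 0 ≤ η) (hm : m * η ≤ 1) (hM : η * M ≤ 2 * (1 - m * η))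
    {z b : V} (h0 : 0 ≤ inner ℝ b z) (hb : ‖b‖ ^ 2 ≤ M * inner ℝ b z) :
    ‖z - η • (m • z + b)‖ ≤ (1 - m * η) * ‖z‖ := by
  have hm' : 0 ≤ 1 - m * η := by linarith
  refine le_of_sq_le_sq ?_ (by positivity)
  have e : z - η • (m • z + b) = (1 - m * η) • z - η • b := by module
  rw [e, norm_sub_sq_real, norm_smul, norm_smul, real_inner_smul_left, real_inner_smul_right,
    Real.norm_of_nonneg hm', Real.norm_of_nonneg hη, real_inner_comm, mul_pow, mul_pow]
  -- Expanding the square, the quadratic term in `b` is absorbed by the cross term thanks to the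
  -- upper bound on `η * M`.
  have h1 : η ^ 2 * ‖b‖ ^ 2 ≤ η ^ 2 * (M * inner ℝ b z) := by gcongr
  have h2 : η * inner ℝ b z * (η * M) ≤ η * inner ℝ b z * (2 * (1 - m * η)) := by gcongr
  nlinarith

end rankOne

/-- Concavity of `σ²` on `[3, ∞)` in secant form. Applying the scalar mean value theorem in each
data direction produces a rank-one term without averaging Hessian matrices. -/
lemma exists_sqSigmoidD_sub {x y : ℝ} (hx : 3 ≤ x) (hy : 3 ≤ y) :
    ∃ k ∈ Set.Icc (0 : ℝ) 1, sqSigmoidD x - sqSigmoidD y = -k * (x - y) := by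
  obtain ⟨z, hz, h⟩ := exists_sub_eq_deriv_mul hasDerivAt_sqSigmoidD (s := Set.Ici 3) hx hy
  exact ⟨-sqSigmoidD2 z, ⟨by linarith [sqSigmoidD2_nonpos hz],
    by linarith [(abs_le.1 (abs_sqSigmoidD2_le z)).1]⟩, by rw [h]; ring⟩

/-- The secant form for the paired centres `±e₁`. Both points lie on the same side of the origin, so
the mean value point also has modulus at least `3`. -/
lemma exists_sqSigmoidD_sub_neg {ς x y : ℝ} (hς : ς = 1 ∨ ς = -1) (hx : 3 ≤ ς * x)
    (hy : 3 ≤ ς * y) : ∃ k ∈ Set.Icc (0 : ℝ) 2,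
      (sqSigmoidD x - sqSigmoidD (-x)) - (sqSigmoidD y - sqSigmoidD (-y)) = -k * (x - y) := by
  have hd : ∀ x, HasDerivAt (fun x => sqSigmoidD x - sqSigmoidD (-x))
      (sqSigmoidD2 x + sqSigmoidD2 (-x)) x := fun x => by
    convert! (hasDerivAt_sqSigmoidD x).sub
      ((hasDerivAt_sqSigmoidD (-x)).comp x (hasDerivAt_neg x)) using 1
    ring
  have key : ∃ z, 3 ≤ |z| ∧ (sqSigmoidD x - sqSigmoidD (-x)) - (sqSigmoidD y - sqSigmoidD (-y)) =
      (sqSigmoidD2 z + sqSigmoidD2 (-z)) * (x - y) := by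
    rcases hς with rfl | rfl
    · obtain ⟨z, hz, h⟩ := exists_sub_eq_deriv_mul hd (s := Set.Ici 3) (x := x) (y := y)
        (by simpa using hx) (by simpa using hy)
      exact ⟨z, (Set.mem_Ici.1 hz).trans (le_abs_self z), h⟩
    · obtain ⟨z, hz, h⟩ := exists_sub_eq_deriv_mul hd (s := Set.Iic (-3)) (x := x) (y := y)
        (by simp; linarith) (by simp; linarith)
      exact ⟨z, by linarith [Set.mem_Iic.1 hz, neg_le_abs z], h⟩
  obtain ⟨z, hz, h⟩ := key
  exact ⟨-(sqSigmoidD2 z + sqSigmoidD2 (-z)), ⟨by linarith [sqSigmoidD2_add_neg_nonpos hz],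
    by linarith [(abs_le.1 (abs_sqSigmoidD2_le z)).1, (abs_le.1 (abs_sqSigmoidD2_le (-z))).1]⟩,
    by rw [h]; ring⟩

/-- In the good region the noise-free gradient behaves like that of a strongly convex quadratic
function. -/
lemma exists_noiseFreeNeuronGrad_sub {τ R ς : ℝ} (hς : ς = 1 ∨ ς = -1) {w v : Vec d}
    (hw : w ∈ goodRegion d τ R ς) (hv : v ∈ goodRegion d τ R ς) :
    ∃ b : Vec d, noiseFreeNeuronGrad d (1 / 800) τ w - noiseFreeNeuronGrad d (1 / 800) τ v =
      (1 / 400 : ℝ) • (w - v) + b ∧ 0 ≤ inner ℝ b (w - v) ∧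
      ‖b‖ ^ 2 ≤ (1 + τ ^ 2 / 2) * inner ℝ b (w - v) := by
  have hs : ∀ w ∈ goodRegion d τ R ς, 3 ≤ τ * coord w 1 + coord w 0 ∧
      3 ≤ τ * coord w 1 - coord w 0 := by
    rintro w ⟨⟨h1, h2⟩, h3, -⟩
    rcases hς with rfl | rfl <;> constructor <;> linarith
  obtain ⟨k0, hk0, h0⟩ := exists_sqSigmoidD_sub_neg hς hw.1.1 hv.1.1
  obtain ⟨k1, hk1, h1⟩ := exists_sqSigmoidD_sub (hs w hw).1 (hs v hv).1
  obtain ⟨k2, hk2, h2⟩ := exists_sqSigmoidD_sub (hs w hw).2 (hs v hv).2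
  set e1 := stdVec d 0
  set e2 := stdVec d 1
  -- Three directions suffice for four centres, because `e₁` and `-e₁` are merged into one.
  set k : Fin 3 → ℝ := ![k0 / 4, k1 / 4, k2 / 4]
  set c : Fin 3 → Vec d := ![e1, e1 + τ • e2, -e1 + τ • e2]
  have hk : ∀ i, 0 ≤ k i := by
    intro i
    fin_cases i
    · exact div_nonneg hk0.1 (by norm_num)
    · exact div_nonneg hk1.1 (by norm_num)
    · exact div_nonneg hk2.1 (by norm_num)
  have hc : ∀ (c : Vec d) (z : Vec d), inner ℝ c z = inner ℝ z c := fun c z =>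
    real_inner_comm _ _
  refine ⟨∑ i, (k i * inner ℝ (c i) (w - v)) • c i, ?_, ?_, ?_⟩
  · simp only [Fin.sum_univ_three, k, c, Matrix.cons_val, hc _ (w - v), inner_add_right,
      inner_neg_right, real_inner_smul_right, e1, e2, inner_stdVec, coord_sub]
    rw [noiseFreeNeuronGrad_eq, noiseFreeNeuronGrad_eq]
    have h0' := sub_eq_iff_eq_add.1 h0
    have h1' := sub_eq_iff_eq_add.1 h1
    have h2' := sub_eq_iff_eq_add.1 h2
    rw [h0', h1', h2']
    module
  · rw [inner_sum_inner_smul]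
    exact Finset.sum_nonneg fun i _ => mul_nonneg (hk i) (sq_nonneg _)
  · rw [inner_sum_inner_smul]
    refine (norm_sum_inner_smul_sq_le hk c _).trans ?_
    have hnn : 0 ≤ ∑ i, k i * inner ℝ (c i) (w - v) ^ 2 :=
      Finset.sum_nonneg fun i _ => mul_nonneg (hk i) (sq_nonneg _)
    refine mul_le_mul_of_nonneg_right ?_ hnn
    have n1 : ‖e1‖ ^ 2 ≤ 1 := pow_le_one₀ (norm_nonneg _) (norm_stdVec_le 0)
    have n2 : ‖τ • e2‖ ^ 2 ≤ τ ^ 2 := by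
      rw [norm_smul, mul_pow, Real.norm_eq_abs, sq_abs]
      exact mul_le_of_le_one_right (sq_nonneg _) (pow_le_one₀ (norm_nonneg _) (norm_stdVec_le 1))
    -- The parallelogram law bounds the two long centres together; with weights `1/4` they
    -- contribute `1/2 + τ²/2`, and `e₁` contributes another `1/2`.
    have hpar := parallelogram_law_with_norm ℝ (τ • e2) e1
    have n3 : ‖e1 + τ • e2‖ ^ 2 + ‖-e1 + τ • e2‖ ^ 2 ≤ 2 * (1 + τ ^ 2) := by
      rw [neg_add_eq_sub, add_comm e1]; nlinarith
    have p1 := sq_nonneg ‖e1 + τ • e2‖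
    have p2 := sq_nonneg ‖-e1 + τ • e2‖
    simp only [Fin.sum_univ_three, k, c, Matrix.cons_val]
    have q0 : k0 / 4 * ‖e1‖ ^ 2 ≤ 1 / 2 := by
      nlinarith [hk0.1, hk0.2, sq_nonneg ‖e1‖]
    have q1 : k1 / 4 * ‖e1 + τ • e2‖ ^ 2 ≤ 1 / 4 * ‖e1 + τ • e2‖ ^ 2 := by
      gcongr; linarith [hk1.2]
    have q2 : k2 / 4 * ‖-e1 + τ • e2‖ ^ 2 ≤ 1 / 4 * ‖-e1 + τ • e2‖ ^ 2 := by
      gcongr; linarith [hk2.2]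
    linarith

end SSL

/-! ### Existence of the noise-free local minimum. -/

namespace SSL

variable {d : ℕ}

/-- First-order condition for a constrained minimum: moving towards another point of a convex set
cannot decrease the function at first order. -/
lemma inner_nonneg_of_isMinOn {V : Type*} [NormedAddCommGroup V] [InnerProductSpace ℝ V]
    [CompleteSpace V] {f : V → ℝ} {K : Set V} (hK : Convex ℝ K) {w g : V} (hw : w ∈ K)
    (hmin : IsMinOn f K w) (hg : HasGradientAt f g w) {z : V} (hz : w + z ∈ K) :
    0 ≤ inner ℝ g z := by
  have h1 : z ∈ posTangentConeAt K w :=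
    mem_posTangentConeAt_of_segment_subset (hK.segment_subset hw hz)
  simpa using hmin.localize.hasFDerivWithinAt_nonneg
    (hasGradientAt_iff_hasFDerivAt.1 hg).hasFDerivWithinAt h1

lemma continuous_coord (k : ℕ) : Continuous fun w : Vec d => coord w k := by
  simp only [← inner_stdVec]; fun_prop

lemma convex_goodRegion (τ R ς : ℝ) : Convex ℝ (goodRegion d τ R ς) := by
  rintro x ⟨hx1, hx2, hx3⟩ y ⟨hy1, hy2, hy3⟩ a b ha hb hab
  refine ⟨?_, ?_, ?_⟩
  · have := convex_Icc (3 : ℝ) 4 hx1 hy1 ha hb hab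
    rw [coord_add, coord_smul, coord_smul]
    convert this using 1
    simp only [smul_eq_mul]; ring
  · have := convex_Ici (8 : ℝ) hx2 hy2 ha hb hab
    rw [coord_add, coord_smul, coord_smul]
    refine this.trans_eq ?_
    simp only [smul_eq_mul]; ring
  · simpa using convex_closedBall (0 : Vec d) R (by simpa using hx3) (by simpa using hy3) ha hb hab

lemma isClosed_goodRegion (τ R ς : ℝ) : IsClosed (goodRegion d τ R ς) := by
  have h0 : IsClosed {w : Vec d | ς * coord w 0 ∈ Set.Icc (3 : ℝ) 4} :=
    isClosed_Icc.preimage (continuous_const.mul (continuous_coord 0))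
  have h1 : IsClosed {w : Vec d | 8 ≤ τ * coord w 1} :=
    isClosed_le continuous_const (continuous_const.mul (continuous_coord 1))
  exact h0.inter (h1.inter (isClosed_le continuous_norm continuous_const))

lemma norm_sq_add_smul_stdVec {k : ℕ} (hk : k < d) (w : Vec d) (c : ℝ) :
    ‖w + c • stdVec d k‖ ^ 2 = ‖w‖ ^ 2 + 2 * c * coord w k + c ^ 2 := by
  rw [norm_add_sq_real, real_inner_smul_right, inner_stdVec, norm_smul, norm_stdVec hk, mul_one,
    Real.norm_eq_abs, sq_abs]
  ring

lemma ext_coord {x y : Vec d} (h : ∀ k < d, coord x k = coord y k) : x = y := by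
  ext i
  simpa [coord] using h i i.2

lemma eq_smul_stdVec_add {w : Vec d} (h : ∀ k, 2 ≤ k → k < d → coord w k = 0) :
    w = coord w 0 • stdVec d 0 + coord w 1 • stdVec d 1 := by
  refine ext_coord fun k hk => ?_
  rw [coord_add, coord_smul, coord_smul, coord_stdVec hk, coord_stdVec hk]
  rcases (by lia : k = 0 ∨ k = 1 ∨ 2 ≤ k) with rfl | rfl | h2
  · simp
  · simp
  · rw [h k h2 hk, if_neg (by lia), if_neg (by lia)]; simp

lemma norm_le_of_coord_eq_zero {w : Vec d} (h : ∀ k, 2 ≤ k → k < d → coord w k = 0) :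
    ‖w‖ ≤ |coord w 0| + |coord w 1| := by
  conv_lhs => rw [eq_smul_stdVec_add h]
  refine (norm_add_le _ _).trans (add_le_add ?_ ?_) <;> rw [norm_smul, Real.norm_eq_abs] <;>
    exact mul_le_of_le_one_right (abs_nonneg _) (norm_stdVec_le _)

/-- The reflection of the first coordinate. -/
noncomputable def reflect (w : Vec d) : Vec d := w - (2 * coord w 0) • stdVec d 0

lemma continuous_reflect : Continuous (reflect (d := d)) :=
  continuous_id.sub ((continuous_const.mul (continuous_coord 0)).smul continuous_const)

lemma coord_reflect_zero (hd : 0 < d) (w : Vec d) : coord (reflect w) 0 = -coord w 0 := by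
  rw [reflect, coord_sub, coord_smul, coord_stdVec hd, if_pos rfl]; ring

lemma coord_reflect {k : ℕ} (hk : k < d) (hk0 : k ≠ 0) (w : Vec d) :
    coord (reflect w) k = coord w k := by
  rw [reflect, coord_sub, coord_smul, coord_stdVec hk, if_neg hk0]; ring

lemma norm_sq_reflect (hd : 0 < d) (w : Vec d) : ‖reflect w‖ ^ 2 = ‖w‖ ^ 2 := by
  rw [reflect, sub_eq_add_neg, ← neg_smul, norm_sq_add_smul_stdVec hd]; ring

lemma reflect_reflect (hd : 0 < d) (w : Vec d) : reflect (reflect w) = w := by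
  rw [reflect, coord_reflect_zero hd, reflect]; module

lemma noiseFreeNeuronLoss_reflect (hd : 2 ≤ d) (α τ : ℝ) (w : Vec d) :
    noiseFreeNeuronLoss d α τ (reflect w) = noiseFreeNeuronLoss d α τ w := by
  simp only [noiseFreeNeuronLoss, norm_sq_reflect (show 0 < d by lia), Fin.sum_univ_four,
    inner_center, coord_reflect_zero (show 0 < d by lia),
    coord_reflect (show 1 < d by lia) one_ne_zero, Matrix.cons_val, neg_neg]
  ring

lemma isLocalMin_noiseFreeNeuronLoss_reflect (hd : 2 ≤ d) {α τ : ℝ} {w : Vec d}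
    (h : IsLocalMin (noiseFreeNeuronLoss d α τ) w) :
    IsLocalMin (noiseFreeNeuronLoss d α τ) (reflect w) := by
  have hc := continuous_reflect.tendsto (reflect w)
  rw [reflect_reflect (by lia)] at hc
  filter_upwards [hc.eventually h] with x hx
  rw [noiseFreeNeuronLoss_reflect hd] at hx ⊢
  exact hx

/-- A minimizer over a compact convex set exists. Testing the first-order condition along coordinate
directions shows that none of the constraints is active, so it is a local minimum without
constraints. -/
lemma exists_isLocalMin_noiseFreeNeuronLoss (hd : 2 ≤ d) {τ : ℝ} (hτ : 7 ≤ τ) :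
    ∃ w : Vec d, IsLocalMin (noiseFreeNeuronLoss d (1 / 800) τ) w ∧
      coord w 0 ∈ Set.Icc (3.1 : ℝ) 3.9 ∧ 9 ≤ τ * coord w 1 ∧ coord w 1 ≤ 2 ∧
      ∀ k, 2 ≤ k → k < d → coord w k = 0 := by
  have hd0 : 0 < d := by lia
  have hd1 : 1 < d := by lia
  have hτ0 : 0 < τ := by linarith
  set f := noiseFreeNeuronLoss d (1 / 800) τ
  set g := noiseFreeNeuronGrad d (1 / 800) τ
  have hfg : ∀ w, HasGradientAt f (g w) w := hasGradientAt_noiseFreeNeuronLoss (1 / 800) τ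
  -- The cap `w⁽²⁾ ≤ 2` adds the missing upper wall. Once the later coordinates vanish, it keeps the
  -- norm at most `4 + 2`, so the radius `10` is never reached.
  set K : Set (Vec d) := goodRegion d τ 10 1 ∩ {w | coord w 1 ≤ 2} with hKdef
  have hcl2 : IsClosed {w : Vec d | coord w 1 ≤ 2} := isClosed_le (continuous_coord 1) continuous_const
  have hKcl : IsClosed K := (isClosed_goodRegion τ 10 1).inter hcl2
  have hKc : IsCompact K := by
    refine (isCompact_closedBall (0 : Vec d) 10).of_isClosed_subset hKcl ?_
    rintro w ⟨⟨-, -, h⟩, -⟩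
    simpa using h
  have hKv : Convex ℝ K := by
    refine (convex_goodRegion τ 10 1).inter ?_
    intro x hx y hy a b ha hb hab
    have := convex_Iic (2 : ℝ) (Set.mem_Iic.2 hx) (Set.mem_Iic.2 hy) ha hb hab
    simpa [coord_add, coord_smul] using this
  have hmem : ∀ w : Vec d, w ∈ K ↔
      (3 ≤ coord w 0 ∧ coord w 0 ≤ 4) ∧ 8 ≤ τ * coord w 1 ∧ ‖w‖ ≤ 10 ∧ coord w 1 ≤ 2 := by
    intro w; simp [hKdef, goodRegion, and_assoc]
  have hKne : K.Nonempty := by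
    refine ⟨(3 : ℝ) • stdVec d 0 + (2 : ℝ) • stdVec d 1, (hmem _).2 ?_⟩
    have hz : ∀ k, 2 ≤ k → k < d →
        coord ((3 : ℝ) • stdVec d 0 + (2 : ℝ) • stdVec d 1 : Vec d) k = 0 := by
      intro k hk hkd
      simp [coord_add, coord_smul, coord_stdVec hkd, show k ≠ 0 by lia, show k ≠ 1 by lia]
    have h := norm_le_of_coord_eq_zero hz
    simp only [coord_add, coord_smul, coord_stdVec hd0, coord_stdVec hd1] at h ⊢
    norm_num at h ⊢
    constructor <;> linarith
  obtain ⟨w, hwK, hmin⟩ := hKc.exists_isMinOn hKne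
    (fun w _ => (hfg w).continuousAt.continuousWithinAt)
  have hdir : ∀ z : Vec d, w + z ∈ K → 0 ≤ inner ℝ (g w) z := fun z hz =>
    inner_nonneg_of_isMinOn hKv hwK hmin (hfg w) hz
  have hdir' : ∀ (k : ℕ) (c : ℝ), w + c • stdVec d k ∈ K → 0 ≤ c * coord (g w) k := by
    intro k c h
    have := hdir _ h
    rwa [real_inner_smul_right, inner_stdVec] at this
  obtain ⟨⟨ha1, ha2⟩, hb1, hn, hb2⟩ := (hmem w).1 hwK
  have hrest : ∀ k, 2 ≤ k → k < d → coord w k = 0 := by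
    intro k hk hkd
    have hk0 : (0 : ℕ) ≠ k := by lia
    have hk1 : (1 : ℕ) ≠ k := by lia
    -- Setting the `k`-th coordinate to zero stays in `K`, and only the regularization acts in that
    -- direction; this forces the coordinate to vanish.
    have h := hdir' k (-coord w k) ((hmem _).2 ?_)
    · have hgk : coord (g w) k = coord w k / 400 := by
        simp only [g, noiseFreeNeuronGrad_eq, coord_sub, coord_smul, coord_add, coord_neg,
          coord_stdVec hkd, hk0.symm, hk1.symm]
        norm_num; ring
      rw [hgk] at h
      have : coord w k ^ 2 ≤ 0 := by nlinarith
      simpa using this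
    · simp only [coord_add, coord_smul, coord_stdVec hd0, coord_stdVec hd1, hk0, hk1, if_false,
        mul_zero, add_zero]
      refine ⟨⟨ha1, ha2⟩, hb1, ?_, hb2⟩
      refine le_of_sq_le_sq ?_ (by norm_num)
      rw [norm_sq_add_smul_stdVec hkd]
      nlinarith [sq_nonneg (coord w k), norm_nonneg w]
  have hmove : ∀ k c, k < 2 → 3 ≤ coord (w + c • stdVec d k) 0 → coord (w + c • stdVec d k) 0 ≤ 4 →
      8 ≤ τ * coord (w + c • stdVec d k) 1 → coord (w + c • stdVec d k) 1 ≤ 2 →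
      0 ≤ c * coord (g w) k := by
    intro k c hk h1 h2 h3 h4
    refine hdir' k c ((hmem _).2 ⟨⟨h1, h2⟩, h3, ?_, h4⟩)
    refine (norm_le_of_coord_eq_zero fun j hj hjd => ?_).trans ?_
    · rw [coord_add, coord_smul, coord_stdVec hjd, if_neg (by lia), hrest j hj hjd]; ring
    · have : 0 ≤ coord (w + c • stdVec d k) 1 := by
        by_contra hneg
        nlinarith
      rw [abs_of_nonneg this, abs_of_nonneg (by linarith)]; linarith
  have hg0 : coord (g w) 0 = firstForce (coord w 0) (τ * coord w 1) / 4 :=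
    coord_zero_noiseFreeNeuronGrad hd τ w
  have hg1 := coord_one_noiseFreeNeuronGrad hd τ w
  have ha1' : 3.1 ≤ coord w 0 := by
    by_contra! hlt
    have h := hmove 0 (3.1 - coord w 0) (by norm_num)
    simp only [coord_add, coord_smul, coord_stdVec hd0, coord_stdVec hd1] at h
    norm_num at h
    have h' := h hb1 hb2
    have hf := first_force_lower ha1 hlt.le hb1
    rw [hg0, firstForce] at h'
    nlinarith
  have ha2' : coord w 0 ≤ 3.9 := by
    by_contra! hlt
    have h := hmove 0 (3.9 - coord w 0) (by norm_num)
    simp only [coord_add, coord_smul, coord_stdVec hd0, coord_stdVec hd1] at h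
    norm_num at h
    have h' := h hb1 hb2
    have hf := first_force_upper hlt.le ha2 hb1
    rw [hg0, firstForce] at h'
    nlinarith
  have hb1' : 9 ≤ τ * coord w 1 := by
    by_contra! hlt
    have h := hmove 1 (9 / τ - coord w 1) (by norm_num)
    simp only [coord_add, coord_smul, coord_stdVec hd0, coord_stdVec hd1] at h
    have e : τ * (9 / τ) = 9 := by field_simp
    have e2 : 9 / τ ≤ 2 := by rw [div_le_iff₀ hτ0]; linarith
    norm_num [e] at h
    have h' := h ha1 ha2 e2
    have hf := second_force_lower ha1 ha2 hb1 hlt.le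
    have hpos : 0 < 9 / τ - coord w 1 := by
      rw [sub_pos, lt_div_iff₀ hτ0]; linarith
    have hneg : coord (g w) 1 < 0 := by
      rw [hg1]
      have : coord w 1 ≤ 9 / τ := by linarith
      have h3 : 9 / τ ≤ 9 / 7 := by gcongr
      nlinarith
    nlinarith
  have hb2' : coord w 1 < 2 := by
    by_contra! hlt
    have hb : coord w 1 = 2 := le_antisymm hb2 hlt
    -- A downward move by `1/2` is feasible, since `τ * (3/2) ≥ 10.5 > 8`.
    have h := hmove 1 (-1 / 2) (by norm_num)
    simp only [coord_add, coord_smul, coord_stdVec hd0, coord_stdVec hd1, hb] at h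
    norm_num at h
    have h' := h ha1 ha2 (by linarith)
    have hf := second_force_upper ha1 ha2 hτ
    rw [hg1, hb, mul_comm τ 2] at h'
    have : τ * (2 * τ / (100 * τ ^ 2)) = 1 / 50 := by field_simp; norm_num
    nlinarith
  refine ⟨w, ?_, ⟨ha1', ha2'⟩, hb1', hb2, hrest⟩
  refine hmin.isLocalMin ?_
  have hn' : ‖w‖ < 10 := by
    refine (norm_le_of_coord_eq_zero hrest).trans_lt ?_
    have : 0 ≤ coord w 1 := by
      by_contra hneg
      nlinarith
    rw [abs_of_nonneg this, abs_of_nonneg (by linarith)]; linarith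
  have c0 := (continuous_coord (d := d) 0).continuousAt (x := w)
  have c1 := (continuous_coord (d := d) 1).continuousAt (x := w)
  filter_upwards [c0.eventually (lt_mem_nhds (show 3 < coord w 0 by linarith)),
    c0.eventually (gt_mem_nhds (show coord w 0 < 4 by linarith)),
    (c1.const_mul τ).eventually (lt_mem_nhds (show 8 < τ * coord w 1 by linarith)),
    c1.eventually (gt_mem_nhds hb2'),
    continuous_norm.continuousAt.eventually (gt_mem_nhds hn')] with x h1 h2 h3 h4 h5
  exact (hmem x).2 ⟨⟨h1.le, h2.le⟩, h3.le, h5.le, h4.le⟩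

end SSL

/-! ### Stability of the minimum and of gradient descent under a small gradient error. -/

namespace SSL

variable {d : ℕ}

/-- A function whose gradient points outwards on a sphere has a local minimum in the ball. -/
lemma exists_isLocalMin_of_inner_pos {f : Vec d → ℝ} {G : Vec d → Vec d}
    (hf : ∀ w, HasGradientAt f (G w) w) {x : Vec d} {r : ℝ} (hr : 0 ≤ r)
    (h : ∀ w, ‖w - x‖ = r → 0 < inner ℝ (G w) (w - x)) :
    ∃ w, ‖w - x‖ ≤ r ∧ IsLocalMin f w := by
  obtain ⟨w, hw, hmin⟩ := (isCompact_closedBall x r).exists_isMinOn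
    ⟨x, Metric.mem_closedBall_self hr⟩ (fun w _ => (hf w).continuousAt.continuousWithinAt)
  have hw' : ‖w - x‖ ≤ r := by simpa [dist_eq_norm] using hw
  refine ⟨w, hw', hmin.isLocalMin ?_⟩
  have hlt : ‖w - x‖ < r := by
    refine lt_of_le_of_ne hw' fun he => ?_
    have h1 := h w he
    have h2 := inner_nonneg_of_isMinOn (convex_closedBall x r) hw hmin (hf w) (z := x - w)
      (by simpa using hr)
    rw [← neg_sub, inner_neg_right] at h2
    linarith
  exact Metric.closedBall_mem_nhds_of_mem (by simpa [dist_eq_norm] using hlt)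

/-- A step of an inexact gradient descent does not leave the good region through the walls given
by the first two coordinates. -/
lemma coord_sub_smul_mem (hd : 2 ≤ d) {τ R ς η : ℝ} (hτ : 7 ≤ τ) (hς : ς = 1 ∨ ς = -1)
    (hη : η = 2 / (4 * (1 / 800) + τ ^ 2 + 1.5)) {w g : Vec d} (hw : w ∈ goodRegion d τ R ς)
    (hg : ‖g - noiseFreeNeuronGrad d (1 / 800) τ w‖ ≤ 1 / 10000) :
    ς * coord (w - η • g) 0 ∈ Set.Icc (3 : ℝ) 4 ∧ 8 ≤ τ * coord (w - η • g) 1 := by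
  obtain ⟨⟨h1, h2⟩, h3, -⟩ := hw
  have hη0 : 0 < η := by rw [hη]; positivity
  have hητ : η * τ ^ 2 ≤ 2 := by
    rw [hη, div_mul_eq_mul_div, div_le_iff₀ (by positivity)]; nlinarith
  have hη1 : η ≤ 1 / 20 := by nlinarith
  have e0 := (abs_le.1 ((abs_coord_le _ 0).trans hg))
  have e1 := (abs_le.1 ((abs_coord_le _ 1).trans hg))
  rw [coord_sub, coord_zero_noiseFreeNeuronGrad hd] at e0
  rw [coord_sub, coord_one_noiseFreeNeuronGrad hd] at e1
  simp only [coord_sub, coord_smul]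
  set a := coord w 0
  set s := τ * coord w 1
  constructor
  · obtain ⟨x, hx, hx1, hx2⟩ : ∃ x, x = ς * a ∧ ς * coord g 0 ≤ firstForce x s / 4 + 1 / 10000 ∧
        firstForce x s / 4 - 1 / 10000 ≤ ς * coord g 0 := by
      refine ⟨ς * a, rfl, ?_⟩
      rcases hς with rfl | rfl
      · simp only [one_mul]; constructor <;> linarith
      · rw [neg_one_mul, neg_one_mul, firstForce_neg]; constructor <;> linarith
    rw [← hx] at h1 h2
    rw [mul_sub, ← hx, mul_left_comm]
    have b1 := abs_le.1 (abs_sqSigmoidD_le x)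
    have b2 := sqSigmoidD_pos x
    have b3 := abs_le.1 (abs_sqSigmoidD_le (-x))
    have b4 := sqSigmoidD_pos (-x)
    have b5 := abs_le.1 (abs_sqSigmoidD_le (s + x))
    have b6 := sqSigmoidD_pos (s + x)
    have b7 := abs_le.1 (abs_sqSigmoidD_le (s - x))
    have b8 := sqSigmoidD_pos (s - x)
    have f1 : firstForce x s ≤ 3 := by unfold firstForce; linarith
    have f2 : -3 ≤ firstForce x s := by unfold firstForce; linarith
    -- One step moves the first coordinate by at most `0.1`, the width of the collars `[3, 3.1]` and
    -- `[3.9, 4]`. From the middle it cannot jump over a wall, and in a collar it moves inwards.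
    have m1 : η * (ς * coord g 0) ≤ 0.1 := by nlinarith
    have m2 : -0.1 ≤ η * (ς * coord g 0) := by nlinarith
    constructor
    · rcases le_or_gt x 3.1 with hlt | hlt
      · have hf := first_force_lower h1 hlt h3
        have : ς * coord g 0 ≤ 0 := by
          refine hx1.trans ?_
          unfold firstForce; linarith
        have := mul_nonpos_of_nonneg_of_nonpos hη0.le this
        linarith
      · linarith
    · rcases le_or_gt x 3.9 with hlt | hlt
      · linarith
      · have hf := first_force_upper hlt.le h2 h3
        have : 0 ≤ ς * coord g 0 := by
          refine le_trans ?_ hx2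
          unfold firstForce; linarith
        have := mul_nonneg hη0.le this
        linarith
  · have hs : τ * (coord w 1 - η * coord g 1) = s - η * (τ * coord g 1) := by ring
    rw [hs]
    have b6 := sqSigmoidD_pos (s + a)
    have b8 := sqSigmoidD_pos (s - a)
    have e2 : τ * coord g 1 ≤ s / 400 - τ ^ 2 / 4 * (sqSigmoidD (s + a) + sqSigmoidD (s - a)) +
        τ / 10000 := by
      have := mul_le_mul_of_nonneg_left e1.2 (show 0 ≤ τ by linarith)
      have e3 : s / 400 = τ * (coord w 1 / 400) := by ring
      rw [e3]; linarith
    rcases le_or_gt s 9 with hlt | hlt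
    · have hf : 0.004 ≤ sqSigmoidD (s + a) + sqSigmoidD (s - a) := by
        rcases hς with rfl | rfl
        · exact second_force_lower (by linarith) (by linarith) h3 hlt
        · have := second_force_lower (a := -a) (s := s) (by linarith) (by linarith) h3 hlt
          rwa [sub_neg_eq_add, ← sub_eq_add_neg, add_comm] at this
      have : τ * coord g 1 ≤ 0 := by nlinarith
      have := mul_nonpos_of_nonneg_of_nonpos hη0.le this
      linarith
    -- Above `s = 9` only regularization and noise can lower `s`, and one step lowers it by far less
    -- than `1`.
    · have h4 : 0 ≤ τ ^ 2 / 4 * (sqSigmoidD (s + a) + sqSigmoidD (s - a)) := by positivity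
      have h5 : η * (τ * coord g 1) ≤ η * (s / 400 + τ / 10000) := by gcongr; linarith
      have h6 : η * τ ≤ 2 := by nlinarith
      nlinarith

/-- In the good region gradient descent contracts towards a critical point. -/
lemma norm_descent_step_le {τ R ς η ε : ℝ} (hς : ς = 1 ∨ ς = -1)
    (hη : η = 2 / (4 * (1 / 800) + τ ^ 2 + 1.5)) {G : Vec d → Vec d} {w v : Vec d}
    (hw : w ∈ goodRegion d τ R ς) (hv : v ∈ goodRegion d τ R ς) (hGv : G v = 0)
    (hG : ‖(G w - noiseFreeNeuronGrad d (1 / 800) τ w) -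
      (G v - noiseFreeNeuronGrad d (1 / 800) τ v)‖ ≤ ε * ‖w - v‖) :
    ‖w - η • G w - v‖ ≤ (1 - η * (1 / 400 - ε)) * ‖w - v‖ := by
  obtain ⟨b, hb, hb0, hb1⟩ := exists_noiseFreeNeuronGrad_sub hς hw hv
  have hη0 : 0 < η := by rw [hη]; positivity
  have hD : 0 < 4 * (1 / 800) + τ ^ 2 + 1.5 := by positivity
  have hηD : η * (4 * (1 / 800) + τ ^ 2 + 1.5) = 2 := by rw [hη]; field_simp
  have e : w - η • G w - v = ((w - v) - η • ((1 / 400 : ℝ) • (w - v) + b)) -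
      η • ((G w - noiseFreeNeuronGrad d (1 / 800) τ w) -
        (G v - noiseFreeNeuronGrad d (1 / 800) τ v)) := by
    rw [← hb, hGv]; module
  rw [e]
  refine (norm_sub_le _ _).trans ?_
  -- The learning rate satisfies `η (τ² + 1.505) = 2`, which implies the required `η (1 + τ²/2) ≤ 2
  -- (1 - η/400)`.
  have h1 := norm_sub_smul_le (m := 1 / 400) hη0.le (by nlinarith [sq_nonneg τ]) (by nlinarith)
    hb0 hb1
  rw [norm_smul, Real.norm_of_nonneg hη0.le]
  have h2 := mul_le_mul_of_nonneg_left hG hη0.le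
  linarith

/-- Gradient descent started in the good region converges linearly to a critical point there. -/
lemma norm_descent_le (hd : 2 ≤ d) {τ ς η ε : ℝ} (hτ : 7 ≤ τ) (hς : ς = 1 ∨ ς = -1)
    (hη : η = 2 / (4 * (1 / 800) + τ ^ 2 + 1.5)) (hε : 0 ≤ ε) (hε' : ε ≤ 1 / 400)
    {G : Vec d → Vec d}
    (hG : ∀ w ∈ goodRegion d τ τ ς, ‖G w - noiseFreeNeuronGrad d (1 / 800) τ w‖ ≤ 1 / 10000)
    (hGL : ∀ w ∈ goodRegion d τ τ ς, ∀ v ∈ goodRegion d τ τ ς,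
      ‖(G w - noiseFreeNeuronGrad d (1 / 800) τ w) -
        (G v - noiseFreeNeuronGrad d (1 / 800) τ v)‖ ≤ ε * ‖w - v‖)
    {v : Vec d} (hv : v ∈ goodRegion d τ τ ς) (hGv : G v = 0) {w : ℕ → Vec d}
    (hw0 : w 0 ∈ goodRegion d τ τ ς) (hwn : ‖w 0‖ + 2 * ‖v‖ ≤ τ)
    (hw : ∀ t, w (t + 1) = w t - η • G (w t)) (t : ℕ) :
    ‖w t - v‖ ≤ (1 - η * (1 / 400 - ε)) ^ t * ‖w 0 - v‖ := by
  have hη0 : 0 < η := by rw [hη]; positivity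
  have hηD : η * (4 * (1 / 800) + τ ^ 2 + 1.5) = 2 := by rw [hη]; field_simp
  set q := 1 - η * (1 / 400 - ε) with hq
  have hq0 : 0 ≤ q := by
    have : η * (1 / 400 - ε) ≤ 1 := by nlinarith [sq_nonneg τ]
    rw [hq]; linarith
  have hq1 : q ≤ 1 := by
    have := mul_nonneg hη0.le (show 0 ≤ 1 / 400 - ε by linarith)
    rw [hq]; linarith
  -- Region and contraction are proved together: contraction needs the iterate in the region, and
  -- the norm constraint of the region follows from contraction via `‖w t‖ ≤ ‖w 0‖ + 2‖v‖ ≤ τ`.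
  suffices h : w t ∈ goodRegion d τ τ ς ∧ ‖w t - v‖ ≤ q ^ t * ‖w 0 - v‖ from h.2
  induction t with
  | zero => exact ⟨hw0, by simp⟩
  | succ t ih =>
    obtain ⟨ih1, ih2⟩ := ih
    have h1 : ‖w (t + 1) - v‖ ≤ q ^ (t + 1) * ‖w 0 - v‖ := by
      rw [hw t]
      refine (norm_descent_step_le hς hη ih1 hv hGv (hGL _ ih1 _ hv)).trans ?_
      calc q * ‖w t - v‖ ≤ q * (q ^ t * ‖w 0 - v‖) := by gcongr
        _ = _ := by ring
    have h2 := coord_sub_smul_mem hd hτ hς hη ih1 (hG _ ih1)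
    rw [← hw t] at h2
    refine ⟨⟨h2.1, h2.2, ?_⟩, h1⟩
    have h3 : ‖w (t + 1) - v‖ ≤ ‖w 0 - v‖ :=
      h1.trans (mul_le_of_le_one_left (norm_nonneg _) (pow_le_one₀ hq0 hq1))
    have h4 : ‖w (t + 1)‖ ≤ ‖w (t + 1) - v‖ + ‖v‖ := by
      simpa using norm_add_le (w (t + 1) - v) v
    linarith [norm_sub_le (w 0) v]

/-- A perturbation of the noise-free loss has a local minimum near the one of the noise-free
loss. -/
lemma exists_isLocalMin_near {τ R ς r ε : ℝ} (hς : ς = 1 ∨ ς = -1) (hr : 0 < r)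
    (hε : 400 * ε < r) {f : Vec d → ℝ} {G : Vec d → Vec d} (hf : ∀ w, HasGradientAt f (G w) w)
    (hG : ∀ w ∈ goodRegion d τ R ς, ‖G w - noiseFreeNeuronGrad d (1 / 800) τ w‖ ≤ ε)
    {x : Vec d} (hx : noiseFreeNeuronGrad d (1 / 800) τ x = 0)
    (hball : ∀ w, ‖w - x‖ ≤ r → w ∈ goodRegion d τ R ς) :
    ∃ w, ‖w - x‖ ≤ r ∧ IsLocalMin f w := by
  refine exists_isLocalMin_of_inner_pos hf hr.le fun w hw => ?_
  have hwK := hball w hw.le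
  have hxK := hball x (by simpa using hr.le)
  obtain ⟨b, hb, hb0, -⟩ := exists_noiseFreeNeuronGrad_sub hς hwK hxK
  rw [hx, sub_zero] at hb
  have e : G w = (1 / 400 : ℝ) • (w - x) + b + (G w - noiseFreeNeuronGrad d (1 / 800) τ w) := by
    rw [← hb]; abel
  have h1 := (abs_le.1 (abs_real_inner_le_norm (G w - noiseFreeNeuronGrad d (1 / 800) τ w)
    (w - x))).1
  have h2 := mul_le_mul_of_nonneg_right (hG w hwK) (norm_nonneg (w - x))
  rw [e, inner_add_left, inner_add_left, real_inner_smul_left, real_inner_self_eq_norm_sq]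
  rw [hw] at h1 h2 ⊢
  nlinarith

end SSL

/-! ### The gradient error of a sample with bounded noise and balanced kinds. -/

namespace SSL
open MeasureTheory ProbabilityTheory

variable {d n : ℕ}

/-- Integrate the pointwise inequality `f ≤ f² / (2δ) + δ / 2`. -/
lemma integral_le_of_integral_sq_le {Ω : Type*} [MeasurableSpace Ω] {μ : Measure Ω}
    [IsProbabilityMeasure μ] {f : Ω → ℝ} {δ : ℝ} (hδ : 0 < δ) (hf : Integrable f μ)
    (hf2 : Integrable (fun ω => f ω ^ 2) μ) (h : ∫ ω, f ω ^ 2 ∂μ ≤ δ ^ 2) : ∫ ω, f ω ∂μ ≤ δ := by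
  have h1 : ∫ ω, f ω ∂μ ≤ ∫ ω, ((2 * δ)⁻¹ * f ω ^ 2 + δ / 2) ∂μ := by
    refine integral_mono hf ((hf2.const_mul _).add (integrable_const _)) fun ω => ?_
    have : (2 * δ)⁻¹ * f ω ^ 2 + δ / 2 - f ω = (2 * δ)⁻¹ * (f ω - δ) ^ 2 := by
      field_simp; ring
    have h2 : 0 ≤ (2 * δ)⁻¹ * (f ω - δ) ^ 2 := by positivity
    change f ω ≤ (2 * δ)⁻¹ * f ω ^ 2 + δ / 2
    linarith
  rw [integral_add (hf2.const_mul _) (integrable_const _), integral_const_mul] at h1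
  have h3 : (2 * δ)⁻¹ * ∫ ω, f ω ^ 2 ∂μ ≤ (2 * δ)⁻¹ * δ ^ 2 := by gcongr
  have h4 : (2 * δ)⁻¹ * δ ^ 2 = δ / 2 := by field_simp
  simp only [integral_const, probReal_univ, one_smul] at h1
  linarith

lemma measurePreserving_eval_stdGaussian (k : Fin d) :
    MeasurePreserving (fun x : Vec d => x k) (stdGaussian (Vec d)) (gaussianReal 0 1) := by
  have := measurePreserving_eval_multivariateGaussian (μ := (0 : Vec d))
    (Matrix.PosSemidef.one (n := Fin d) (R := ℝ)) (i := k)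
  rw [multivariateGaussian_zero_one] at this
  simpa using this

lemma integral_norm_sq_stdGaussian : ∫ x, ‖x‖ ^ 2 ∂(stdGaussian (Vec d)) = d := by
  have hi : ∀ k : Fin d, Integrable (fun x : Vec d => x k ^ 2) (stdGaussian (Vec d)) := by
    intro k
    refine ((measurePreserving_eval_stdGaussian k).integrable_comp
      (g := fun z => z ^ 2) (by fun_prop)).2 ?_
    exact (IsGaussian.memLp_two_id (μ := gaussianReal 0 1)).integrable_sq
  have h1 : ∀ k : Fin d, ∫ x : Vec d, x k ^ 2 ∂(stdGaussian (Vec d)) = 1 := by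
    intro k
    have h2 := variance_fun_id_gaussianReal (μ := 0) (v := 1)
    rw [variance_eq_integral (by fun_prop)] at h2
    simp only [integral_id_gaussianReal, sub_zero, NNReal.coe_one] at h2
    rw [← h2, ← (measurePreserving_eval_stdGaussian k).map_eq, integral_map (by fun_prop)
      (by fun_prop)]
  simp only [EuclideanSpace.real_norm_sq_eq]
  rw [integral_finsetSum _ fun k _ => hi k]
  simp [h1]

lemma integrable_norm_sq_augLaw (ρ : ℝ) :
    Integrable (fun x : Vec d => ‖x‖ ^ 2) (augLaw d ρ) :=
  (memLp_two_id_augLaw ρ).integrable_norm_pow two_ne_zero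

lemma integral_norm_sq_augLaw (ρ : ℝ) : ∫ x, ‖x‖ ^ 2 ∂(augLaw d ρ) = ρ ^ 2 * d := by
  rw [augLaw, integral_map (by fun_prop) (by fun_prop)]
  simp only [norm_smul, mul_pow, Real.norm_eq_abs, sq_abs]
  rw [integral_const_mul, integral_norm_sq_stdGaussian]

lemma integrable_norm_add_sq_augLaw (ρ : ℝ) (a : Vec d) :
    Integrable (fun ξ => ‖a + ξ‖ ^ 2) (augLaw d ρ) := by
  have hL : MemLp (fun ξ => a + ξ) 2 (augLaw d ρ) := (memLp_const a).add (memLp_two_id_augLaw ρ)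
  exact hL.integrable_norm_pow two_ne_zero

lemma integral_norm_add_sq_augLaw_le {ρ X : ℝ} {a : Vec d} (ha : ‖a‖ ≤ X)
    (hdX : ρ ^ 2 * d ≤ X ^ 2) : ∫ ξ, ‖a + ξ‖ ^ 2 ∂(augLaw d ρ) ≤ (2 * X) ^ 2 := by
  have hc : Integrable (fun _ : Vec d => 2 * X ^ 2) (augLaw d ρ) := integrable_const _
  have hn : Integrable (fun ξ : Vec d => 2 * ‖ξ‖ ^ 2) (augLaw d ρ) :=
    (integrable_norm_sq_augLaw ρ).const_mul 2
  have h3 : ∫ ξ, ‖a + ξ‖ ^ 2 ∂(augLaw d ρ) ≤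
      ∫ ξ : Vec d, (2 * X ^ 2 + 2 * ‖ξ‖ ^ 2) ∂(augLaw d ρ) := by
    refine integral_mono (integrable_norm_add_sq_augLaw ρ a) (hc.add hn) fun ξ => ?_
    change ‖a + ξ‖ ^ 2 ≤ 2 * X ^ 2 + 2 * ‖ξ‖ ^ 2
    have h4 : ‖a + ξ‖ ≤ X + ‖ξ‖ := (norm_add_le _ _).trans (by gcongr)
    calc ‖a + ξ‖ ^ 2 ≤ (X + ‖ξ‖) ^ 2 := by gcongr
      _ ≤ 2 * X ^ 2 + 2 * ‖ξ‖ ^ 2 := by nlinarith [sq_nonneg (X - ‖ξ‖)]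
  rw [integral_add hc hn, integral_const_mul 2 fun x : Vec d => ‖x‖ ^ 2, integral_norm_sq_augLaw]
    at h3
  simp only [integral_const, probReal_univ, one_smul] at h3
  linarith

/-- The moments of the distance between an augmented datapoint and its noise-free version. -/
lemma augmented_moments {τ ρ X : ℝ} (S : Sample d n) (i : Fin n) (hρ : 0 < ρ) (hX : 0 < X)
    (hdX : (d : ℝ) ≤ X ^ 2) (hS : ‖(S i).2‖ ≤ X) :
    Integrable (fun ξ => ‖datapoint τ ρ S i + ξ - center d τ (S i).1‖ ^ 2) (augLaw d ρ) ∧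
    ∫ ξ, ‖datapoint τ ρ S i + ξ - center d τ (S i).1‖ ^ 2 ∂(augLaw d ρ) ≤ (2 * ρ * X) ^ 2 ∧
    ∫ ξ, ‖datapoint τ ρ S i + ξ - center d τ (S i).1‖ ∂(augLaw d ρ) ≤ 2 * ρ * X := by
  have e : ∀ ξ, datapoint τ ρ S i + ξ - center d τ (S i).1 = ρ • (S i).2 + ξ := by
    intro ξ; simp only [datapoint]; abel
  simp only [e]
  have ha : ‖ρ • (S i).2‖ ≤ ρ * X := by
    rw [norm_smul, Real.norm_of_nonneg hρ.le]; gcongr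
  have hd : ρ ^ 2 * d ≤ (ρ * X) ^ 2 := by rw [mul_pow]; gcongr
  have h2 := integral_norm_add_sq_augLaw_le ha hd
  have h3 := ((integrable_add_augLaw ρ (ρ • (S i).2)).norm)
  have h4 := integral_le_of_integral_sq_le (by positivity) h3
    (integrable_norm_add_sq_augLaw ρ (ρ • (S i).2)) h2
  rw [mul_assoc]
  exact ⟨integrable_norm_add_sq_augLaw ρ _, h2, h4⟩

/-- The fraction of the datapoints of kind `c`. -/
noncomputable def kindFraction (S : Sample d n) (c : Fin 4) : ℝ :=
  (1 / (n : ℝ)) * ∑ i, if (S i).1 = c then 1 else 0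

lemma average_kind (S : Sample d n) (F : Fin 4 → Vec d) :
    (1 / (n : ℝ)) • ∑ i, F (S i).1 = ∑ c, kindFraction S c • F c := by
  simp only [kindFraction, mul_smul, Finset.sum_smul]
  rw [← Finset.smul_sum, Finset.sum_comm]
  simp

/-- The error of the gradient caused by the noise in the `i`-th datapoint. -/
noncomputable def gradError (τ ρ : ℝ) (S : Sample d n) (i : Fin n) (w : Vec d) : Vec d :=
  (2 * avgNeuron (augLaw d ρ) (fun ξ => datapoint τ ρ S i + ξ) w) •
      avgNeuronGrad (augLaw d ρ) (fun ξ => datapoint τ ρ S i + ξ) w -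
    sqSigmoidD (inner ℝ w (center d τ (S i).1)) • center d τ (S i).1

/-- The regularization cancels, and the error separates into the noise of the individual points and
the imbalance of the four kinds. The two are controlled by different concentration events. -/
lemma neuronGrad_sub_noiseFreeNeuronGrad (α τ ρ : ℝ) (S : Sample d n) (w : Vec d) :
    neuronGrad α τ ρ S w - noiseFreeNeuronGrad d α τ w =
      -((1 / (n : ℝ)) • ∑ i, gradError τ ρ S i w +
        ∑ c, (kindFraction S c - 1 / 4) •
          sqSigmoidD (inner ℝ w (center d τ c)) • center d τ c) := by
  have h := average_kind S fun c => sqSigmoidD (inner ℝ w (center d τ c)) • center d τ c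
  simp only [sub_smul (kindFraction S _), Finset.sum_sub_distrib, ← h, ← Finset.smul_sum]
  simp only [gradError, Finset.sum_sub_distrib, neuronGrad, noiseFreeNeuronGrad]
  module

lemma norm_average_le (hn : 0 < n) {F : Fin n → Vec d} {b : ℝ} (h : ∀ i, ‖F i‖ ≤ b) :
    ‖(1 / (n : ℝ)) • ∑ i, F i‖ ≤ b := by
  have hn' : (0 : ℝ) < n := by exact_mod_cast hn
  rw [norm_smul, Real.norm_of_nonneg (by positivity)]
  have : ‖∑ i, F i‖ ≤ n * b := (norm_sum_le_of_le _ fun i _ => h i).trans_eq (by simp)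
  calc 1 / (n : ℝ) * ‖∑ i, F i‖ ≤ 1 / n * (n * b) := by gcongr
    _ = b := by field_simp

variable {τ ρ X θ R : ℝ} {S : Sample d n}

lemma norm_sum_kind_le {a : Fin 4 → ℝ} {F : Fin 4 → Vec d} {b : ℝ}
    (ha : ∀ c, |a c| ≤ θ) (h : ∀ c, ‖F c‖ ≤ b) : ‖∑ c, a c • F c‖ ≤ 4 * θ * b := by
  have hθ : 0 ≤ θ := (abs_nonneg _).trans (ha 0)
  refine (norm_sum_le_of_le (f := fun c => a c • F c) (n := fun _ => θ * b) _ fun c _ => ?_).trans_eq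
    (by simp; ring)
  rw [norm_smul, Real.norm_eq_abs]
  exact mul_le_mul (ha c) (h c) (norm_nonneg _) hθ

lemma norm_neuronGrad_sub_le (hn : 0 < n) (hτ : 0 ≤ τ) (hρ : 0 < ρ) (hX : 0 < X)
    (hdX : (d : ℝ) ≤ X ^ 2) (hR : 1 ≤ R) (hRX : R * (2 * ρ * X) ≤ 1)
    (hS : ∀ i, ‖(S i).2‖ ≤ X) (hθ : ∀ c, |kindFraction S c - 1 / 4| ≤ θ) (α : ℝ)
    {w : Vec d} (hw : ‖w‖ ≤ R) :
    ‖neuronGrad α τ ρ S w - noiseFreeNeuronGrad d α τ w‖ ≤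
      8 * R * (1 + τ) * (2 * ρ * X) + 4 * θ * (1 + τ) := by
  have hδ : 2 * ρ * X ≤ 1 := (le_mul_of_one_le_left (by positivity) hR).trans hRX
  rw [neuronGrad_sub_noiseFreeNeuronGrad, norm_neg]
  refine (norm_add_le _ _).trans (add_le_add (norm_average_le hn fun i => ?_)
    (norm_sum_kind_le hθ fun c => ?_))
  · obtain ⟨-, -, h3⟩ := augmented_moments (τ := τ) S i hρ hX hdX (hS i)
    exact norm_sq_avgNeuron_grad_sub_le (integrable_add_augLaw ρ _) h3 (norm_center_le hτ _)
      (by linarith) hR hw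
  · rw [norm_smul]
    exact (mul_le_of_le_one_left (norm_nonneg _) (abs_sqSigmoidD_le _)).trans (norm_center_le hτ c)

lemma norm_neuronGrad_sub_sub_le (hn : 0 < n) (hτ : 0 ≤ τ) (hρ : 0 < ρ) (hX : 0 < X)
    (hdX : (d : ℝ) ≤ X ^ 2) (hR : 1 ≤ R) (hRX : R * (2 * ρ * X) ≤ 1)
    (hS : ∀ i, ‖(S i).2‖ ≤ X) (hθ : ∀ c, |kindFraction S c - 1 / 4| ≤ θ) (α : ℝ)
    {w v : Vec d} (hw : ‖w‖ ≤ R) (hv : ‖v‖ ≤ R) :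
    ‖(neuronGrad α τ ρ S w - noiseFreeNeuronGrad d α τ w) -
      (neuronGrad α τ ρ S v - noiseFreeNeuronGrad d α τ v)‖ ≤
      (30 * R * (1 + τ) ^ 2 * (2 * ρ * X) + 4 * θ * (1 + τ) ^ 2) * ‖w - v‖ := by
  have e : (neuronGrad α τ ρ S w - noiseFreeNeuronGrad d α τ w) -
      (neuronGrad α τ ρ S v - noiseFreeNeuronGrad d α τ v) =
      -((1 / (n : ℝ)) • ∑ i, (gradError τ ρ S i w - gradError τ ρ S i v) +
        ∑ c, (kindFraction S c - 1 / 4) •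
          (sqSigmoidD (inner ℝ w (center d τ c)) - sqSigmoidD (inner ℝ v (center d τ c))) •
            center d τ c) := by
    rw [neuronGrad_sub_noiseFreeNeuronGrad, neuronGrad_sub_noiseFreeNeuronGrad]
    simp only [sub_smul (sqSigmoidD _), smul_sub, Finset.sum_sub_distrib]
    abel
  rw [e, norm_neg, add_mul]
  refine (norm_add_le _ _).trans (add_le_add (norm_average_le hn fun i => ?_) ?_)
  · obtain ⟨h1, h2, h3⟩ := augmented_moments (τ := τ) S i hρ hX hdX (hS i)
    exact norm_sq_avgNeuron_grad_sub_sub_le (integrable_add_augLaw ρ _) h1 h3 h2 hRX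
      (norm_center_le hτ _) (by linarith) hR hw hv
  · rw [mul_assoc (4 * θ)]
    refine norm_sum_kind_le hθ fun c => ?_
    have hc := norm_center_le (d := d) hτ c
    rw [norm_smul, Real.norm_eq_abs]
    have h1 : |sqSigmoidD (inner ℝ w (center d τ c)) - sqSigmoidD (inner ℝ v (center d τ c))| ≤
        ‖w - v‖ * (1 + τ) := by
      refine (abs_sub_le_of_hasDerivAt hasDerivAt_sqSigmoidD abs_sqSigmoidD2_le _ _).trans ?_
      rw [← inner_sub_left]
      exact (abs_real_inner_le_norm _ _).trans (by gcongr)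
    calc _ ≤ (‖w - v‖ * (1 + τ)) * (1 + τ) := by gcongr
      _ = _ := by ring

end SSL

/-! ### Concentration of the noise and of the kind frequencies. -/

namespace SSL
open MeasureTheory ProbabilityTheory

variable {d n : ℕ}

lemma hasSubgaussianMGF_id_gaussianReal : HasSubgaussianMGF id 1 (gaussianReal 0 1) where
  integrable_exp_mul t := integrable_exp_mul_gaussianReal t
  mgf_le t := by simp [mgf_id_gaussianReal]

lemma gaussianReal_abs_ge_le {T : ℝ} (hT : 0 ≤ T) :
    (gaussianReal 0 1).real {x | T ≤ |x|} ≤ 2 * Real.exp (-T ^ 2 / 2) := by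
  have h1 := hasSubgaussianMGF_id_gaussianReal.measure_ge_le hT
  have h2 := hasSubgaussianMGF_id_gaussianReal.neg.measure_ge_le hT
  simp only [NNReal.coe_one, mul_one, id, Pi.neg_apply] at h1 h2
  calc (gaussianReal 0 1).real {x | T ≤ |x|}
      ≤ (gaussianReal 0 1).real ({x | T ≤ x} ∪ {x | T ≤ -x}) := by
        refine measureReal_mono fun x hx => ?_
        rcases le_abs.1 (show T ≤ |x| from hx) with h | h
        · exact Or.inl h
        · exact Or.inr h
    _ ≤ (gaussianReal 0 1).real {x | T ≤ x} + (gaussianReal 0 1).real {x | T ≤ -x} := measureReal_union_le _ _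
    _ ≤ _ := by linarith

instance isProbabilityMeasure_sampleLaw : IsProbabilityMeasure (sampleLaw d n) := by
  unfold sampleLaw; infer_instance

lemma measurePreserving_noise_coord (i : Fin n) (k : Fin d) :
    MeasurePreserving (fun S : Sample d n => (S i).2 k) (sampleLaw d n) (gaussianReal 0 1) :=
  (measurePreserving_eval_stdGaussian k).comp
    (measurePreserving_snd.comp (measurePreserving_eval (fun _ : Fin n =>
      (uniformOn (Set.univ : Set (Fin 4))).prod (stdGaussian (Vec d))) i))

lemma sampleLaw_noise_ge_le {T : ℝ} (hT : 0 ≤ T) (i : Fin n) (k : Fin d) :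
    (sampleLaw d n).real {S | T ≤ |(S i).2 k|} ≤ 2 * Real.exp (-T ^ 2 / 2) := by
  refine le_trans (le_of_eq ?_) (gaussianReal_abs_ge_le hT)
  exact (measurePreserving_noise_coord i k).measureReal_preimage
    (measurableSet_le measurable_const measurable_id.abs).nullMeasurableSet

/-- Hoeffding's inequality for a function of the single entries of the dataset. -/
lemma sampleLaw_sum_ge_le {f : Fin 4 × Vec d → ℝ} (hf : Measurable f) {a : ℝ}
    (hfa : ∀ x, f x ∈ Set.Icc a (a + 1)) {ε : ℝ} (hε : 0 ≤ ε) :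
    (sampleLaw d n).real {S | ε ≤ ∑ i, (f (S i) -
      ∫ x, f x ∂((uniformOn (Set.univ : Set (Fin 4))).prod (stdGaussian (Vec d))))} ≤
      Real.exp (-(2 * ε ^ 2 / n)) := by
  set μ := (uniformOn (Set.univ : Set (Fin 4))).prod (stdGaussian (Vec d))
  have hsub : HasSubgaussianMGF (fun x => f x - ∫ x, f x ∂μ) ((‖(a + 1) - a‖₊ / 2) ^ 2) μ :=
    hasSubgaussianMGF_of_mem_Icc hf.aemeasurable (.of_forall hfa)
  have hind : iIndepFun (fun (i : Fin n) (S : Sample d n) => f (S i) - ∫ x, f x ∂μ)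
      (sampleLaw d n) :=
    iIndepFun_pi (X := fun (_ : Fin n) x => f x - ∫ x, f x ∂μ) fun i =>
      (hf.sub_const _).aemeasurable
  have h := HasSubgaussianMGF.measure_sum_ge_le_of_iIndepFun hind (s := Finset.univ)
    (c := fun _ => (‖(a + 1) - a‖₊ / 2) ^ 2) (fun i _ => ?_) hε
  · refine h.trans_eq ?_
    congr 1
    simp only [add_sub_cancel_left, nnnorm_one, Finset.sum_const, Finset.card_univ,
      Fintype.card_fin, nsmul_eq_mul]
    push_cast
    rcases eq_or_ne (n : ℝ) 0 with h0 | h0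
    · simp [h0]
    · field_simp
  · have he : MeasurePreserving (fun S : Sample d n => S i) (sampleLaw d n) μ :=
      measurePreserving_eval (fun _ : Fin n => μ) i
    refine HasSubgaussianMGF.of_map (X := fun x => f x - ∫ x, f x ∂μ) he.measurable.aemeasurable ?_
    rw [he.map_eq]; exact hsub

lemma integral_kind (c : Fin 4) : ∫ x, (if x.1 = c then (1 : ℝ) else 0)
    ∂((uniformOn (Set.univ : Set (Fin 4))).prod (stdGaussian (Vec d))) = 1 / 4 := by
  have h := integral_prod_mul (μ := uniformOn (Set.univ : Set (Fin 4)))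
    (ν := stdGaussian (Vec d)) (fun k => if k = c then (1 : ℝ) else 0) fun _ => (1 : ℝ)
  simp only [mul_one, integral_const, probReal_univ, smul_eq_mul] at h
  rw [h]
  have h1 : (fun k : Fin 4 => if k = c then (1 : ℝ) else 0) = Set.indicator {c} 1 := by
    ext k; simp [Set.indicator_apply]
  rw [h1, integral_indicator_one (measurableSet_singleton c), measureReal_def, uniformOn_univ]
  simp

lemma sampleLaw_kindFraction_ge_le (hn : 0 < n) {θ : ℝ} (hθ : 0 ≤ θ) (c : Fin 4) :
    (sampleLaw d n).real {S | θ ≤ |kindFraction S c - 1 / 4|} ≤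
      2 * Real.exp (-(2 * n * θ ^ 2)) := by
  have hn' : (0 : ℝ) < n := by exact_mod_cast hn
  set f : Fin 4 × Vec d → ℝ := fun x => if x.1 = c then 1 else 0
  have hf : Measurable f :=
    Measurable.ite (measurable_fst (measurableSet_singleton c)) measurable_const measurable_const
  have hε : 0 ≤ n * θ := by positivity
  have h1 := sampleLaw_sum_ge_le (n := n) hf (a := 0) (fun x => by
    simp only [f]; split_ifs <;> norm_num) hε
  -- The lower tail is the upper tail of `-f`, which takes values in `[-1, 0]`; hence `a = -1`.
  have h2 := sampleLaw_sum_ge_le (n := n) hf.neg (a := -1) (fun x => by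
    simp only [f, Pi.neg_apply]; split_ifs <;> norm_num) hε
  simp only [Pi.neg_apply, integral_neg] at h2
  have e1 : ∫ x, f x ∂((uniformOn (Set.univ : Set (Fin 4))).prod (stdGaussian (Vec d))) = 1 / 4 :=
    integral_kind c
  rw [e1] at h1 h2
  have e2 : 2 * (n * θ) ^ 2 / n = 2 * n * θ ^ 2 := by field_simp
  rw [e2] at h1 h2
  have hS : ∀ S : Sample d n, ∑ i, f (S i) = n * kindFraction S c := by
    intro S; simp only [kindFraction, f]; field_simp
  calc _ ≤ (sampleLaw d n).real ({S | n * θ ≤ ∑ i, (f (S i) - 1 / 4)} ∪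
          {S | n * θ ≤ ∑ i, (-f (S i) - -(1 / 4))}) := by
        refine measureReal_mono fun S hs => ?_
        have h3 : ∑ i, (f (S i) - 1 / 4) = n * (kindFraction S c - 1 / 4) := by
          rw [Finset.sum_sub_distrib, hS]; simp; ring
        have h4 : ∑ i, (-f (S i) - -(1 / 4)) = n * -(kindFraction S c - 1 / 4) := by
          rw [Finset.sum_sub_distrib, Finset.sum_neg_distrib, hS]; simp; ring
        simp only [Set.mem_union, Set.mem_ofPred_eq, h3, h4]
        rcases le_abs.1 (show θ ≤ |kindFraction S c - 1 / 4| from hs) with h | h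
        · exact Or.inl (by gcongr)
        · exact Or.inr (by gcongr)
    _ ≤ _ := measureReal_union_le _ _
    _ ≤ _ := by linarith

/-- With high probability all noise vectors are bounded and all kinds are equally frequent. -/
lemma sampleLaw_bad_le (hn : 0 < n) {T θ : ℝ} (hT : 0 ≤ T) (hθ : 0 ≤ θ) :
    (sampleLaw d n).real {S | ¬ ((∀ i k, |(S i).2 k| ≤ T) ∧
      ∀ c, |kindFraction S c - 1 / 4| ≤ θ)} ≤
      n * d * (2 * Real.exp (-T ^ 2 / 2)) + 8 * Real.exp (-(2 * n * θ ^ 2)) := by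
  calc _ ≤ (sampleLaw d n).real ((⋃ p : Fin n × Fin d, {S | T ≤ |(S p.1).2 p.2|}) ∪
          ⋃ c : Fin 4, {S | θ ≤ |kindFraction S c - 1 / 4|}) := by
        refine measureReal_mono fun S hs => ?_
        simp only [Set.mem_union, Set.mem_iUnion, Set.mem_ofPred_eq]
        by_contra! h
        exact hs ⟨fun i k => (h.1 (i, k)).le, fun c => (h.2 c).le⟩
    _ ≤ _ := measureReal_union_le _ _
    _ ≤ (∑ p : Fin n × Fin d, 2 * Real.exp (-T ^ 2 / 2)) +
        ∑ c : Fin 4, 2 * Real.exp (-(2 * n * θ ^ 2)) := by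
      refine add_le_add ((measureReal_iUnion_fintype_le _).trans (Finset.sum_le_sum fun p _ => ?_))
        ((measureReal_iUnion_fintype_le _).trans (Finset.sum_le_sum fun c _ => ?_))
      · exact sampleLaw_noise_ge_le hT p.1 p.2
      · exact sampleLaw_kindFraction_ge_le hn hθ c
    _ = _ := by simp; ring

end SSL

/-! ### Conclusions for a good sample, in powers of `T = d^(1/10)`. -/

namespace SSL
open MeasureTheory ProbabilityTheory

variable {d n : ℕ}

lemma norm_sq_le_of_coord_le (hd : 2 ≤ d) {u : ℝ} {w : Vec d}
    (h : ∀ k, 2 ≤ k → k < d → |coord w k| ≤ u) :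
    ‖w‖ ^ 2 ≤ d * u ^ 2 + coord w 0 ^ 2 + coord w 1 ^ 2 := by
  have h0 : 0 < d := by lia
  have h1 : 1 < d := by lia
  rw [EuclideanSpace.real_norm_sq_eq]
  calc ∑ i, w i ^ 2 ≤ ∑ i : Fin d, (u ^ 2 + (if i = ⟨0, h0⟩ then coord w 0 ^ 2 else 0) +
        (if i = ⟨1, h1⟩ then coord w 1 ^ 2 else 0)) := by
        refine Finset.sum_le_sum fun i _ => ?_
        have hi : w i = coord w i := by simp [coord]
        rcases (by lia : i.val = 0 ∨ i.val = 1 ∨ 2 ≤ i.val) with hi0 | hi1 | hi2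
        · have e : i = ⟨0, h0⟩ := Fin.ext hi0
          rw [hi, hi0, if_pos e, if_neg (by rw [e]; simp)]
          nlinarith [sq_nonneg u]
        · have e : i = ⟨1, h1⟩ := Fin.ext hi1
          rw [hi, hi1, if_pos e, if_neg (by rw [e]; simp)]
          nlinarith [sq_nonneg u]
        · have hle := h i hi2 i.2
          rw [if_neg (fun e => by simp [e] at hi2), if_neg (fun e => by simp [e] at hi2), hi,
            add_zero, add_zero, ← sq_abs]
          gcongr
    _ = _ := by
      rw [Finset.sum_add_distrib, Finset.sum_add_distrib, Finset.sum_ite_eq', Finset.sum_ite_eq']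
      simp

lemma norm_le_of_coord_le_of_dim_mul_sq_le {X T : ℝ} (hX : 0 ≤ X) (hd : (d : ℝ) * T ^ 2 ≤ X ^ 2)
    {x : Vec d} (h : ∀ k, |x k| ≤ T) : ‖x‖ ≤ X := by
  refine le_of_sq_le_sq ?_ hX
  rw [EuclideanSpace.real_norm_sq_eq]
  refine le_trans ?_ hd
  calc ∑ i, x i ^ 2 ≤ ∑ _i : Fin d, T ^ 2 := by
        refine Finset.sum_le_sum fun i _ => ?_
        rw [← sq_abs]
        gcongr
        exact h i
    _ = _ := by simp

section goodSample

variable {T : ℝ} {S : Sample d n}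

/-- The numerical bounds on the gradient error for a good sample in high dimension. -/
lemma gradient_error_bounds (hT : 1000 ≤ T) (hdT : (d : ℝ) = T ^ 10) (hn : 0 < n)
    (hS : ∀ i k, |(S i).2 k| ≤ T) (hθ : ∀ c, |kindFraction S c - 1 / 4| ≤ (T ^ 6)⁻¹) (α : ℝ) :
    (∀ w : Vec d, ‖w‖ ≤ T →
      ‖neuronGrad α T (T ^ 15)⁻¹ S w - noiseFreeNeuronGrad d α T w‖ ≤ 9 / T ^ 5) ∧
    (∀ w v : Vec d, ‖w‖ ≤ T → ‖v‖ ≤ T →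
      ‖(neuronGrad α T (T ^ 15)⁻¹ S w - noiseFreeNeuronGrad d α T w) -
        (neuronGrad α T (T ^ 15)⁻¹ S v - noiseFreeNeuronGrad d α T v)‖ ≤ 1 / T * ‖w - v‖) := by
  have hT0 : 0 < T := by linarith
  have hT1 : 1 ≤ T := by linarith
  -- Coordinates at most `T` in dimension `T^10` give norm at most `T^6`; with `ρ = T^(-15)` the
  -- displacement scale is `2 / T^9`.
  have hξ : ∀ i, ‖(S i).2‖ ≤ T ^ 6 := fun i =>
    norm_le_of_coord_le_of_dim_mul_sq_le (by positivity) (by rw [hdT]; ring_nf; rfl) (hS i)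
  have hdX : (d : ℝ) ≤ (T ^ 6) ^ 2 := by
    rw [hdT, ← pow_mul]; exact pow_le_pow_right₀ hT1 (by norm_num)
  have e9 : 2 * (T ^ 15)⁻¹ * T ^ 6 = 2 / T ^ 9 := by field_simp
  have hRX : T * (2 * (T ^ 15)⁻¹ * T ^ 6) ≤ 1 := by
    rw [e9, mul_div_assoc', div_le_one (by positivity)]
    have : T ^ 9 = T * T * T ^ 7 := by ring
    have h7 : 1 ≤ T ^ 7 := one_le_pow₀ hT1
    rw [this]; nlinarith
  have hρ : 0 < (T ^ 15)⁻¹ := by positivity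
  have hX : 0 < T ^ 6 := by positivity
  have h2T : 1 + T ≤ 2 * T := by linarith
  have hT2 : 1000000 ≤ T ^ 2 := by nlinarith
  constructor
  · intro w hw
    refine (norm_neuronGrad_sub_le hn hT0.le hρ hX hdX hT1 hRX hξ hθ α hw).trans ?_
    rw [e9]
    calc 8 * T * (1 + T) * (2 / T ^ 9) + 4 * (T ^ 6)⁻¹ * (1 + T)
        ≤ 8 * T * (2 * T) * (2 / T ^ 9) + 4 * (T ^ 6)⁻¹ * (2 * T) := by gcongr
      _ = (32 / T ^ 2 + 8) / T ^ 5 := by field_simp; ring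
      _ ≤ 9 / T ^ 5 := by
        gcongr
        have : 32 / T ^ 2 ≤ 1 := by rw [div_le_one (by positivity)]; linarith
        linarith
  · intro w v hw hv
    refine (norm_neuronGrad_sub_sub_le hn hT0.le hρ hX hdX hT1 hRX hξ hθ α hw hv).trans ?_
    gcongr
    rw [e9]
    calc 30 * T * (1 + T) ^ 2 * (2 / T ^ 9) + 4 * (T ^ 6)⁻¹ * (1 + T) ^ 2
        ≤ 30 * T * (2 * T) ^ 2 * (2 / T ^ 9) + 4 * (T ^ 6)⁻¹ * (2 * T) ^ 2 := by gcongr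
      _ = (240 / T ^ 5 + 16 / T ^ 3) / T := by field_simp; ring
      _ ≤ 1 / T := by
        gcongr
        have h3 : 1000 ≤ T ^ 3 := hT.trans (le_self_pow₀ hT1 (by norm_num))
        have h5 : 1000 ≤ T ^ 5 := hT.trans (le_self_pow₀ hT1 (by norm_num))
        have a1 : 240 / T ^ 5 ≤ 240 / 1000 := by gcongr
        have a2 : 16 / T ^ 3 ≤ 16 / 1000 := by gcongr
        linarith

/-- For a good sample, each neuron has a local minimum near the noise-free one, and gradient
descent converges to it. -/
lemma exists_neuron_minimum (hd : 2 ≤ d) (hT : 1000 ≤ T) (hdT : (d : ℝ) = T ^ 10) (hn : 0 < n)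
    (hS : ∀ i k, |(S i).2 k| ≤ T) (hθ : ∀ c, |kindFraction S c - 1 / 4| ≤ (T ^ 6)⁻¹) {ς η u : ℝ}
    (hς : ς = 1 ∨ ς = -1) (hη : η = 2 / (4 * (1 / 800) + T ^ 2 + 1.5)) (hu : d * u ^ 2 ≤ 9 * T)
    {x : Vec d} (hx : noiseFreeNeuronGrad d (1 / 800) T x = 0)
    (hx0 : ς * coord x 0 ∈ Set.Icc (3.1 : ℝ) 3.9) (hx1 : 9 ≤ T * coord x 1) (hx2 : coord x 1 ≤ 2)
    (hxr : ∀ k, 2 ≤ k → k < d → coord x k = 0) :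
    ∃ v, ‖v - x‖ ≤ 4000 / T ^ 5 ∧ IsLocalMin (neuronLoss (1 / 800) T (T ^ 15)⁻¹ S) v ∧
      ∀ w : ℕ → Vec d, ς * coord (w 0) 0 ∈ Set.Ioo (3.1 : ℝ) 3.9 →
        T * coord (w 0) 1 ∈ Set.Ioo (8.5 : ℝ) 9 →
        (∀ k, 2 ≤ k → k < d → |coord (w 0) k| ≤ u) →
        (∀ t, w (t + 1) = w t - η • neuronGrad (1 / 800) T (T ^ 15)⁻¹ S (w t)) →
        ∀ t, ‖w t - v‖ ≤ (1 - η * (1 / 400 - 1 / T)) ^ t * ‖w 0 - v‖ := by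
  have hT0 : 0 < T := by linarith
  have hT1 : 1 ≤ T := by linarith
  obtain ⟨hE, hEL⟩ := gradient_error_bounds hT hdT hn hS hθ (1 / 800)
  have hς1 : |ς| = 1 := by rcases hς with rfl | rfl <;> simp
  have h4 : 1000 ^ 4 ≤ T ^ 4 := by gcongr
  have h5 : T ^ 5 = T * T ^ 4 := by ring
  have hr1 : T * (4000 / T ^ 5) ≤ 0.01 := by
    rw [h5]
    have e : T * (4000 / (T * T ^ 4)) = 4000 / T ^ 4 := by field_simp
    rw [e, div_le_iff₀ (by positivity)]; norm_num at h4 ⊢; linarith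
  have hr0 : 0 < 4000 / T ^ 5 := by positivity
  have hr2 : 4000 / T ^ 5 ≤ 0.01 := by nlinarith
  have hb0 : 0 ≤ coord x 1 := by
    by_contra hneg
    nlinarith
  have hxn : ‖x‖ ≤ 6 := by
    refine (norm_le_of_coord_eq_zero hxr).trans ?_
    have e : |coord x 0| = |ς * coord x 0| := by rw [abs_mul, hς1, one_mul]
    rw [e, abs_of_nonneg hb0, abs_of_nonneg (by linarith [hx0.1])]
    linarith [hx0.2]
  have hball : ∀ w, ‖w - x‖ ≤ 4000 / T ^ 5 → w ∈ goodRegion d T T ς ∧ ‖w‖ ≤ 7 := by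
    intro w hw
    have c0 := (abs_coord_le (w - x) 0).trans hw
    have c1 := abs_le.1 ((abs_coord_le (w - x) 1).trans hw)
    have c0' : |ς * coord w 0 - ς * coord x 0| ≤ 4000 / T ^ 5 := by
      rw [← mul_sub, abs_mul, hς1, one_mul, ← coord_sub]; exact c0
    rw [coord_sub] at c1
    have hw7 : ‖w‖ ≤ 7 := by
      have : ‖w‖ ≤ ‖w - x‖ + ‖x‖ := by simpa using norm_add_le (w - x) x
      linarith
    have c2 := abs_le.1 c0'
    refine ⟨⟨⟨by linarith [hx0.1], by linarith [hx0.2]⟩, ?_, by linarith⟩, hw7⟩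
    have := mul_le_mul_of_nonneg_left c1.1 hT0.le
    linarith
  -- The strong convexity constant `1/400` turns the gradient error `9 / T^5` into a distance of
  -- `3600 / T^5`, below the radius `4000 / T^5`.
  obtain ⟨v, hv, hvmin⟩ := exists_isLocalMin_near (R := T) (ε := 9 / T ^ 5) hς hr0
    (by rw [mul_div_assoc']; gcongr; norm_num)
    (hasGradientAt_neuronLoss (1 / 800) T (T ^ 15)⁻¹ S) (fun w hw => hE w hw.2.2) hx
    (fun w hw => (hball w hw).1)
  refine ⟨v, hv, hvmin, fun w hw0 hw1 hwr hw => ?_⟩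
  -- The squared norm of the initialization is at most `9T + 17`, well below `T² / 4`. This leaves
  -- room for `2‖v‖ ≤ 14` in the norm budget `T`.
  have hwn : ‖w 0‖ ≤ T / 2 := by
    refine le_of_sq_le_sq ?_ (by positivity)
    refine (norm_sq_le_of_coord_le hd hwr).trans ?_
    have e : coord (w 0) 0 ^ 2 = (ς * coord (w 0) 0) ^ 2 := by
      rw [mul_pow, ← sq_abs ς, hς1]; ring
    have q0 : coord (w 0) 0 ^ 2 ≤ 16 := by rw [e]; nlinarith [hw0.1, hw0.2]
    have q1 : 0 ≤ coord (w 0) 1 := by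
      by_contra hneg
      nlinarith [hw1.1]
    have q2 : coord (w 0) 1 ≤ 1 := by
      by_contra! hneg
      nlinarith [hw1.2]
    nlinarith
  refine norm_descent_le hd (by linarith) hς hη (by positivity)
    ?_ (fun w hw => (hE w hw.2.2).trans ?_) (fun w hw v hv => hEL w v hw.2.2 hv.2.2) (hball v hv).1
    (gradient_eq_zero_of_isLocalMin hvmin (hasGradientAt_neuronLoss _ _ _ _ _))
    ⟨⟨by linarith [hw0.1], by linarith [hw0.2]⟩, by linarith [hw1.1], by linarith⟩
    (by linarith [(hball v hv).2]) hw
  · exact one_div_le_one_div_of_le (by norm_num) (by linarith)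
  · have h6 : 1000 * 1000 ^ 4 ≤ T * T ^ 4 := by gcongr
    rw [h5, div_le_div_iff₀ (by positivity) (by norm_num)]
    norm_num at h6 ⊢
    linarith

end goodSample

/-- The projection fixes `v` and does not increase the norm of `e - v`, so one error is paid for
`‖v‖` and one for the projected remainder. -/
lemma one_sub_le_norm_starProjection {V : Type*} [NormedAddCommGroup V] [InnerProductSpace ℝ V]
    (U : Submodule ℝ V) [U.HasOrthogonalProjection] {e v : V} (he : ‖e‖ = 1) (hv : v ∈ U) :
    1 - 2 * ‖e - v‖ ≤ ‖U.starProjection e‖ := by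
  have h1 : U.starProjection e = v + U.starProjection (e - v) := by
    rw [map_sub, Submodule.starProjection_eq_self_iff.2 hv]; abel
  have h2 := U.norm_starProjection_apply_le (e - v)
  have h3 : ‖e‖ ≤ ‖v‖ + ‖e - v‖ := by simpa using norm_add_le v (e - v)
  have h4 := norm_sub_le (v + U.starProjection (e - v)) (U.starProjection (e - v))
  rw [add_sub_cancel_right] at h4
  rw [h1]
  linarith

/-- If the rows of `W` are close to those of a noise-free minimizer, then the row space of `W`
almost contains the first two basis vectors. -/
lemma projLength_ge (hd : 2 ≤ d) {r : ℝ} {x : Vec d} (hx0 : 3 ≤ coord x 0)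
    (hx1 : 0 < coord x 1) (hxr : ∀ k, 2 ≤ k → k < d → coord x k = 0) {W : Weights d}
    (h0 : ‖W 0 - x‖ ≤ r) (h1 : ‖W 1 - reflect x‖ ≤ r) :
    1 - r ≤ projLength W (stdVec d 0) ∧ 1 - 2 * (r / coord x 1) ≤ projLength W (stdVec d 1) := by
  have hm0 : W 0 ∈ Submodule.span ℝ ({W 0, W 1} : Set (Vec d)) :=
    Submodule.subset_span (by simp)
  have hm1 : W 1 ∈ Submodule.span ℝ ({W 0, W 1} : Set (Vec d)) :=
    Submodule.subset_span (by simp)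
  have hr : 0 ≤ r := (norm_nonneg _).trans h0
  have hx := eq_smul_stdVec_add hxr
  set a := coord x 0 with ha
  set b := coord x 1
  have hrx : reflect x = -a • stdVec d 0 + b • stdVec d 1 := by
    rw [reflect, ← ha]
    conv_lhs => rw [hx]
    module
  have ha0 : (2 * a) ≠ 0 := by linarith
  have hb0 : (2 * b) ≠ 0 := by linarith
  constructor
  · refine le_trans ?_ (one_sub_le_norm_starProjection _ (norm_stdVec (by lia))
      (Submodule.smul_mem _ (2 * a)⁻¹ (Submodule.sub_mem _ hm0 hm1)))
    -- The exact rows satisfy `x - reflect x = 2a e₁`; in the other case `x + reflect x = 2b e₂`.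
    have e : stdVec d 0 - (2 * a)⁻¹ • (W 0 - W 1) =
        (2 * a)⁻¹ • ((W 1 - reflect x) - (W 0 - x)) := by
      rw [hrx]
      nth_rewrite 1 [hx]
      have : stdVec d 0 = (2 * a)⁻¹ • (2 * a) • stdVec d 0 := by rw [inv_smul_smul₀ ha0]
      nth_rewrite 1 [this]
      module
    rw [e, norm_smul, norm_inv, Real.norm_of_nonneg (by linarith)]
    have h2 := (norm_sub_le (W 1 - reflect x) (W 0 - x)).trans (add_le_add h1 h0)
    have h3 : (2 * a)⁻¹ ≤ (4 : ℝ)⁻¹ := by gcongr; linarith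
    have h4 : (2 * a)⁻¹ * ‖W 1 - reflect x - (W 0 - x)‖ ≤ 4⁻¹ * (r + r) := by gcongr
    linarith
  · refine le_trans ?_ (one_sub_le_norm_starProjection _ (norm_stdVec (by lia))
      (Submodule.smul_mem _ (2 * b)⁻¹ (Submodule.add_mem _ hm0 hm1)))
    have e : stdVec d 1 - (2 * b)⁻¹ • (W 0 + W 1) =
        -((2 * b)⁻¹ • ((W 1 - reflect x) + (W 0 - x))) := by
      rw [hrx]
      nth_rewrite 1 [hx]
      have : stdVec d 1 = (2 * b)⁻¹ • (2 * b) • stdVec d 1 := by rw [inv_smul_smul₀ hb0]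
      nth_rewrite 1 [this]
      module
    rw [e, norm_neg, norm_smul, norm_inv, Real.norm_of_nonneg (by linarith)]
    have h2 := (norm_add_le (W 1 - reflect x) (W 0 - x)).trans (add_le_add h1 h0)
    have h4 : (2 * b)⁻¹ * ‖W 1 - reflect x + (W 0 - x)‖ ≤ (2 * b)⁻¹ * (r + r) := by gcongr
    have h5 : (2 * b)⁻¹ * (r + r) = r / b := by field_simp; ring
    linarith

end SSL

/-! ### Convergence rate, failure probability and assembly. -/

namespace SSL
open MeasureTheory ProbabilityTheory

/-- The rate of gradient descent in terms of the condition number. -/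
lemma condition_rate_eq {T : ℝ} (hT : 1000 ≤ T) {η κ : ℝ}
    (hη : η = 2 / (4 * (1 / 800) + T ^ 2 + 1.5))
    (hκ : κ = 1 + (T ^ 2 + 1.5 + 2 * T⁻¹) / (2 * (1 / 800) - T⁻¹)) :
    (κ - 1) / (κ + 1) = 1 - η * (1 / 400 - 1 / T) := by
  have hT0 : 0 < T := by linarith
  obtain ⟨m, hm⟩ : ∃ m, m = 1 / 400 - 1 / T := ⟨_, rfl⟩
  have hm0 : 0 < m := by
    have : 1 / T ≤ 1 / 1000 := one_div_le_one_div_of_le (by norm_num) hT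
    linarith
  have e1 : 2 * (1 / 800) - T⁻¹ = m := by rw [hm]; ring
  have e2 : T ^ 2 + 1.5 + 2 * T⁻¹ = (4 * (1 / 800) + T ^ 2 + 1.5) - 2 * m := by rw [hm]; ring
  rw [e1, e2] at hκ
  rw [← hm, hκ, hη]
  have hD : 0 < 4 * (1 / 800) + T ^ 2 + 1.5 := by positivity
  generalize 4 * (1 / 800) + T ^ 2 + 1.5 = D at *
  -- Here `κ + 1 = D / m` and `κ - 1 = (D - 2m) / m`, so the ratio is `1 - 2m / D = 1 - η m`.
  have h3 : 1 + (D - 2 * m) / m + 1 = D / m := by field_simp; ring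
  have h4 : 1 + (D - 2 * m) / m - 1 = (D - 2 * m) / m := by ring
  rw [h3, h4]
  field_simp

lemma failure_probability_le {T : ℝ} (hT : 1000 ≤ T) :
    T ^ 20 * T ^ 10 * (2 * Real.exp (-T ^ 2 / 2)) +
      8 * Real.exp (-(2 * T ^ 20 * (T ^ 6)⁻¹ ^ 2)) ≤
      (2 * (Nat.factorial 30 : ℝ) + 8) * Real.exp (-T) := by
  have hT0 : 0 < T := by linarith
  -- The union bound runs over `n d = T^30` Gaussian coordinates. This costs a factor `30! e^T`,
  -- which `e^(-T²/2)` absorbs.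
  have h1 : T ^ 30 ≤ (Nat.factorial 30 : ℝ) * Real.exp T := by
    have h := Real.pow_div_factorial_le_exp T hT0.le 30
    rwa [div_le_iff₀ (by positivity), mul_comm] at h
  have h2 : Real.exp T * Real.exp (-T ^ 2 / 2) ≤ Real.exp (-T) := by
    rw [← Real.exp_add]
    exact Real.exp_le_exp.2 (by nlinarith)
  have h3 : Real.exp (-(2 * T ^ 20 * (T ^ 6)⁻¹ ^ 2)) ≤ Real.exp (-T) := by
    refine Real.exp_le_exp.2 (neg_le_neg ?_)
    have e : 2 * T ^ 20 * (T ^ 6)⁻¹ ^ 2 = 2 * T ^ 8 := by field_simp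
    rw [e]
    have : T ≤ T ^ 8 := le_self_pow₀ (by linarith) (by norm_num)
    linarith
  calc _ = 2 * (T ^ 30 * Real.exp (-T ^ 2 / 2)) +
        8 * Real.exp (-(2 * T ^ 20 * (T ^ 6)⁻¹ ^ 2)) := by ring
    _ ≤ 2 * ((Nat.factorial 30 : ℝ) * Real.exp T * Real.exp (-T ^ 2 / 2)) +
        8 * Real.exp (-T) := by gcongr
    _ = 2 * (Nat.factorial 30 : ℝ) * (Real.exp T * Real.exp (-T ^ 2 / 2)) +
        8 * Real.exp (-T) := by ring
    _ ≤ 2 * (Nat.factorial 30 : ℝ) * Real.exp (-T) + 8 * Real.exp (-T) := by gcongr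
    _ = _ := by ring

/-- There are minimizers of the noise-free loss whose rows are reflections of each other. -/
lemma exists_noiseFree_minimizer {d : ℕ} (hd : 2 ≤ d) {τ : ℝ} (hτ : 7 ≤ τ) :
    ∃ x : Vec d, IsLocalMin (noiseFreeNeuronLoss d (1 / 800) τ) x ∧
      IsLocalMin (noiseFreeNeuronLoss d (1 / 800) τ) (reflect x) ∧
      coord x 0 ∈ Set.Icc (3.1 : ℝ) 3.9 ∧ 9 ≤ τ * coord x 1 ∧ coord x 1 ≤ 2 ∧
      ∀ k, 2 ≤ k → k < d → coord x k = 0 := by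
  obtain ⟨x, h, h'⟩ := exists_isLocalMin_noiseFreeNeuronLoss hd hτ
  exact ⟨x, h, isLocalMin_noiseFreeNeuronLoss_reflect hd h, h'⟩

/-- The conclusions about `loss` for a good sample in high dimension. -/
lemma exists_loss_minimum {d n : ℕ} (hd : 2 ≤ d) {T : ℝ} (hT : 1000 ≤ T)
    (hdT : (d : ℝ) = T ^ 10) (hn : 0 < n) {η u : ℝ}
    (hη : η = 2 / (4 * (1 / 800) + T ^ 2 + 1.5)) (hu : d * u ^ 2 ≤ 9 * T)
    {x : Vec d} (hxmin : IsLocalMin (noiseFreeNeuronLoss d (1 / 800) T) x)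
    (hxmin' : IsLocalMin (noiseFreeNeuronLoss d (1 / 800) T) (reflect x))
    (hx0 : coord x 0 ∈ Set.Icc (3.1 : ℝ) 3.9) (hx1 : 9 ≤ T * coord x 1) (hx2 : coord x 1 ≤ 2)
    (hxr : ∀ k, 2 ≤ k → k < d → coord x k = 0) {S : Sample d n}
    (hS : ∀ i k, |(S i).2 k| ≤ T) (hθ : ∀ c, |kindFraction S c - 1 / 4| ≤ (T ^ 6)⁻¹) :
    ∃ Ws : Weights d, IsLocalMin (loss (1 / 800) T (T ^ 15)⁻¹ S) Ws ∧
      ‖Ws 0 - x‖ ≤ 4000 / T ^ 5 ∧ ‖Ws 1 - reflect x‖ ≤ 4000 / T ^ 5 ∧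
      ∀ W : ℕ → Weights d,
        coord (W 0 0) 0 ∈ Set.Ioo (3.1 : ℝ) 3.9 → T * coord (W 0 0) 1 ∈ Set.Ioo (8.5 : ℝ) 9 →
        (∀ k, 2 ≤ k → k < d → |coord (W 0 0) k| ≤ u) →
        coord (W 0 1) 0 ∈ Set.Ioo (-3.9 : ℝ) (-3.1) → T * coord (W 0 1) 1 ∈ Set.Ioo (8.5 : ℝ) 9 →
        (∀ k, 2 ≤ k → k < d → |coord (W 0 1) k| ≤ u) →
        IsGradientDescent (loss (1 / 800) T (T ^ 15)⁻¹ S) η W → ∀ t,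
        ‖W t 0 - Ws 0‖ ≤ (1 - η * (1 / 400 - 1 / T)) ^ t * ‖W 0 0 - Ws 0‖ ∧
        ‖W t 1 - Ws 1‖ ≤ (1 - η * (1 / 400 - 1 / T)) ^ t * ‖W 0 1 - Ws 1‖ := by
  have hg : ∀ {y : Vec d}, IsLocalMin (noiseFreeNeuronLoss d (1 / 800) T) y →
      noiseFreeNeuronGrad d (1 / 800) T y = 0 := fun h =>
    gradient_eq_zero_of_isLocalMin h (hasGradientAt_noiseFreeNeuronLoss _ _ _)
  have hr1 : coord (reflect x) 1 = coord x 1 := coord_reflect (by lia) one_ne_zero x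
  obtain ⟨v, hv, hvmin, hvgd⟩ := exists_neuron_minimum hd hT hdT hn hS hθ (ς := 1) (Or.inl rfl) hη
    hu (hg hxmin) (by simpa using hx0) hx1 hx2 hxr
  obtain ⟨v', hv', hvmin', hvgd'⟩ := exists_neuron_minimum hd hT hdT hn hS hθ (ς := -1)
    (Or.inr rfl) hη hu (hg hxmin') (by rw [coord_reflect_zero (by lia)]; simpa using hx0)
    (by rwa [hr1]) (by rwa [hr1])
    (fun k hk hkd => by rw [coord_reflect hkd (by lia), hxr k hk hkd])
  refine ⟨WithLp.toLp 2 ![v, v'], isLocalMin_loss hvmin hvmin', hv, hv',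
    fun W h0 h1 h2 h0' h1' h2' hW t => ⟨?_, ?_⟩⟩
  · exact hvgd (fun t => W t 0) (by simpa using h0) h1 h2 (fun t => hW.neuron 0 t) t
  · refine hvgd' (fun t => W t 1) ?_ h1' h2' (fun t => hW.neuron 1 t) t
    exact ⟨by linarith [h0'.2], by linarith [h0'.1]⟩

end SSL

open SSL MeasureTheory

theorem theorem1 :
    ∃ C : ℝ, 0 < C ∧
      ∀ (d n : ℕ) (α τ ρ η κ : ℝ), 2 ≤ d →
        n = d ^ 2 →
        α = 1 / 800 →
        τ = max 7 ((d : ℝ) ^ (1 / 10 : ℝ)) →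
        ρ = 1 / (d : ℝ) ^ (1.5 : ℝ) →
        η = 2 / (4 * α + τ ^ 2 + 1.5) →
        κ = 1 + (τ ^ 2 + 1.5 + 2 * (d : ℝ) ^ (-0.1 : ℝ)) / (2 * α - (d : ℝ) ^ (-0.1 : ℝ)) →
        ∃ Wt : SSL.Weights d,
          -- the noise-free critical point, which does not depend on the sample
          HasGradientAt (SSL.noiseFreeLoss d α τ) 0 Wt ∧
          IsLocalMin (SSL.noiseFreeLoss d α τ) Wt ∧
          SSL.coord (Wt 0) 0 ∈ Set.Icc (3.1 : ℝ) 3.9 ∧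
          SSL.coord (Wt 0) 0 = -SSL.coord (Wt 1) 0 ∧
          τ * SSL.coord (Wt 0) 1 = τ * SSL.coord (Wt 1) 1 ∧
          9 ≤ τ * SSL.coord (Wt 0) 1 ∧
          (∀ k, 2 ≤ k → k < d → SSL.coord (Wt 0) k = 0 ∧ SSL.coord (Wt 1) k = 0) ∧
          -- the event that the claims below fail has (outer) probability `O(exp (-d^(1/10)))`
          SSL.sampleLaw d n
            {S | ¬ ∃ Ws : SSL.Weights d,
              IsLocalMin (SSL.loss α τ ρ S) Ws ∧
              ‖Ws 0 - Wt 0‖ ≤ C * (d : ℝ) ^ (-(1 / 2) : ℝ) ∧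
              ‖Ws 1 - Wt 1‖ ≤ C * (d : ℝ) ^ (-(1 / 2) : ℝ) ∧
              (∀ W : ℕ → SSL.Weights d,
                W 0 0 ∈ SSL.D₁ d τ → W 0 1 ∈ SSL.D₂ d τ →
                SSL.IsGradientDescent (SSL.loss α τ ρ S) η W →
                ∀ t : ℕ,
                  ‖W t 0 - Ws 0‖ ≤ ((κ - 1) / (κ + 1)) ^ t * ‖W 0 0 - Ws 0‖ ∧
                  ‖W t 1 - Ws 1‖ ≤ ((κ - 1) / (κ + 1)) ^ t * ‖W 0 1 - Ws 1‖) ∧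
              1 - C * (τ ^ 3 * (d : ℝ) ^ (-(1 / 2) : ℝ)) ≤
                SSL.projLength Ws (SSL.stdVec d 0) ∧
              1 - C * (τ ^ 3 * (d : ℝ) ^ (-(1 / 2) : ℝ)) ≤
                SSL.projLength Ws (SSL.stdVec d 1)}
            ≤ ENNReal.ofReal (C * Real.exp (-(d : ℝ) ^ (1 / 10 : ℝ))) := by
  -- The three demands on `C` come from the distance and projection bounds, from the trivial case `T
  -- < 1000`, and from the failure probability.
  obtain ⟨C, hC1, hC2, hC3⟩ : ∃ C : ℝ, 4000 ≤ C ∧ Real.exp 1000 ≤ C ∧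
      2 * (Nat.factorial 30 : ℝ) + 8 ≤ C :=
    ⟨max 4000 (max (Real.exp 1000) (2 * (Nat.factorial 30 : ℝ) + 8)), le_max_left _ _,
      (le_max_left _ _).trans (le_max_right _ _), (le_max_right _ _).trans (le_max_right _ _)⟩
  refine ⟨C, by linarith, fun d n α τ ρ η κ hd hn hα hτ hρ hη hκ => ?_⟩
  subst hα
  have hτ7 : 7 ≤ τ := hτ ▸ le_max_left _ _
  have hd0 : (0 : ℝ) ≤ d := Nat.cast_nonneg d
  obtain ⟨x, hxmin, hxmin', hx0, hx1, hx2, hxr⟩ := exists_noiseFree_minimizer hd hτ7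
  have hr1 : coord (reflect x) 1 = coord x 1 := coord_reflect (by lia) one_ne_zero x
  have hmin : IsLocalMin (noiseFreeLoss d (1 / 800) τ) (WithLp.toLp 2 ![x, reflect x]) :=
    isLocalMin_noiseFreeLoss hxmin hxmin'
  refine ⟨WithLp.toLp 2 ![x, reflect x], hasGradientAt_noiseFreeLoss_zero hmin, hmin, hx0,
    ?_, ?_, hx1, fun k hk hkd => ⟨hxr k hk hkd, ?_⟩, ?_⟩
  · change coord x 0 = -coord (reflect x) 0
    rw [coord_reflect_zero (by lia), neg_neg]
  · change τ * coord x 1 = τ * coord (reflect x) 1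
    rw [hr1]
  · change coord (reflect x) k = 0
    rw [coord_reflect hkd (by lia), hxr k hk hkd]
  obtain ⟨T, hT⟩ : ∃ T, T = (d : ℝ) ^ (1 / 10 : ℝ) := ⟨_, rfl⟩
  have hT0 : 0 < T := by
    rw [hT]; exact Real.rpow_pos_of_pos (by exact_mod_cast (by lia : 0 < d)) _
  -- Below the threshold `C e^(-T) ≥ 1`, so only the noise-free claims have content. Above it, `τ =
  -- T` and `1/T < 1/400`.
  rcases lt_or_ge T 1000 with hlt | hge
  · refine prob_le_one.trans ?_
    rw [← ENNReal.ofReal_one, ← hT]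
    refine ENNReal.ofReal_le_ofReal ?_
    calc (1 : ℝ) = Real.exp 1000 * Real.exp (-1000) := by rw [← Real.exp_add]; norm_num
      _ ≤ C * Real.exp (-T) := by gcongr
  have hdT : (d : ℝ) = T ^ 10 := by
    rw [hT, ← Real.rpow_natCast, ← Real.rpow_mul hd0]; norm_num
  have hpow : ∀ a : ℝ, (d : ℝ) ^ a = T ^ (10 * a) := by
    intro a
    rw [hdT, ← Real.rpow_natCast, ← Real.rpow_mul hT0.le]; norm_num
  have e1 : (d : ℝ) ^ (-(1 / 2) : ℝ) = (T ^ 5)⁻¹ := by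
    rw [hpow, ← Real.rpow_natCast, ← Real.rpow_neg hT0.le]; norm_num
  have e2 : (d : ℝ) ^ (-0.1 : ℝ) = T⁻¹ := by
    rw [hpow, ← Real.rpow_neg_one]; norm_num
  have e3 : (d : ℝ) ^ (1.5 : ℝ) = T ^ 15 := by
    rw [hpow, ← Real.rpow_natCast]; norm_num
  have hτT : T = τ := by rw [hτ, ← hT]; exact (max_eq_right (by linarith)).symm
  subst hτT
  have hρ' : ρ = (T ^ 15)⁻¹ := by rw [hρ, e3, one_div]
  subst hρ'
  rw [e2] at hκ
  -- The initialization box contributes `9 d^(0.02) = 9 T^(0.2)` to the squared norm; the cruder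
  -- bound `9T` is enough.
  have hu : d * (3 / (d : ℝ) ^ (0.49 : ℝ)) ^ 2 ≤ 9 * T := by
    have e4 : T ^ 9 ≤ ((d : ℝ) ^ (0.49 : ℝ)) ^ 2 := by
      rw [hpow, ← Real.rpow_mul_natCast hT0.le, ← Real.rpow_natCast]
      exact Real.rpow_le_rpow_of_exponent_le (by linarith) (by norm_num)
    rw [div_pow, mul_div_assoc', div_le_iff₀ (lt_of_lt_of_le (by positivity) e4)]
    calc (d : ℝ) * 3 ^ 2 = 9 * T * T ^ 9 := by rw [hdT]; ring
      _ ≤ _ := by gcongr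
  have hn0 : 0 < n := by rw [hn]; positivity
  have hnT : (n : ℝ) = T ^ 20 := by rw [hn]; push_cast; rw [hdT, ← pow_mul]
  have hbad := sampleLaw_bad_le (d := d) hn0 hT0.le (θ := (T ^ 6)⁻¹) (by positivity)
  rw [hnT, hdT] at hbad
  rw [← hT]
  have hprob := ENNReal.ofReal_le_ofReal (hbad.trans ((failure_probability_le hge).trans
    (mul_le_mul_of_nonneg_right hC3 (Real.exp_pos _).le)))
  rw [ofReal_measureReal] at hprob
  -- Only an inclusion in the bad event is needed, so the failure set need not be shown measurable.
  refine (measure_mono fun S hS => ?_).trans hprob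
  rw [Set.mem_ofPred_eq] at hS ⊢
  refine fun hgood => hS ?_
  obtain ⟨Ws, hWs, hWs0, hWs1, hgd⟩ :=
    exists_loss_minimum hd hge hdT hn0 hη hu hxmin hxmin' hx0 hx1 hx2 hxr hgood.1 hgood.2
  have hr0 : 0 ≤ 1 / T ^ 5 := by positivity
  have hCr : 4000 / T ^ 5 ≤ C * (T ^ 5)⁻¹ := by rw [← div_eq_mul_inv]; gcongr
  have hbx : 0 < coord x 1 := by
    by_contra hneg
    nlinarith
  obtain ⟨hp0, hp1⟩ := projLength_ge hd (by linarith [hx0.1]) hbx hxr hWs0 hWs1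
  rw [condition_rate_eq hge hη hκ, e1]
  refine ⟨Ws, hWs, hWs0.trans hCr, hWs1.trans hCr, fun W hW0 hW1 hW => ?_, ?_, ?_⟩
  · exact hgd W hW0.1 hW0.2.1 (fun k hk hkd => abs_le.2 (Set.Ioo_subset_Icc_self (hW0.2.2 k hk hkd)))
      hW1.1 hW1.2.1 (fun k hk hkd => abs_le.2 (Set.Ioo_subset_Icc_self (hW1.2.2 k hk hkd))) hW
  · refine le_trans ?_ hp0
    have : 1 * (T ^ 5)⁻¹ ≤ T ^ 3 * (T ^ 5)⁻¹ := by
      gcongr; exact one_le_pow₀ (by linarith)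
    nlinarith
  · refine le_trans ?_ hp1
    -- The second coordinate may be as small as `9 / T`, so recovering `e₂` loses a factor `T`, well
    -- within the allowed `τ³`.
    have h1 : 9 / T ≤ coord x 1 := by rw [div_le_iff₀ hT0]; linarith
    have h2 : 4000 / T ^ 5 / coord x 1 ≤ 4000 / T ^ 5 / (9 / T) := by gcongr
    have h3 : 4000 / T ^ 5 / (9 / T) = 4000 / 9 * (T * (T ^ 5)⁻¹) := by field_simp
    have h4 : T * (T ^ 5)⁻¹ ≤ T ^ 3 * (T ^ 5)⁻¹ := by
      gcongr; exact le_self_pow₀ (by linarith) (by norm_num)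
    have h5 : 0 ≤ T ^ 3 * (T ^ 5)⁻¹ := by positivity
    have h6 := mul_le_mul_of_nonneg_right hC1 h5
    linarith
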